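/- For $\tau\in\mathcal H=\{\tau\in\mathbb C:\operatorname{Im}\tau>0\}$ put $q=e^{2\pi i\tau}$, $q^{-1/4}=e^{-\pi i\tau/2}$, $(z;q)_\infty=\prod_{j\ge 0}(1-zq^j)$, $[z;q]_\infty=(z;q)_\infty(q/z;q)_\infty$ and $\zeta_c=e^{2\pi i/c}$. An overpartition of $n$ is a partition of $n$ in which the first appearance of each part size may be overlined; its rank is its largest part minus its number of parts (and $0$ for the empty overpartition). Let $\overline N(m,n)$ be the number of overpartitions of $n$ of rank $m$, and $$\mathcal O(z;\tau)=\sum_{n=0}^\infty\sum_{m=-\infty}^\infty\overline N(m,n)z^mq^n .$$ Moreover let $$\vartheta(z;\tau)=\sum_{n\in\mathbb Z+\frac12}e^{\pi in^2\tau+2\pi in(z+\frac12)},\qquad \mu(u,v;\tau)=\frac{e^{\pi iu}}{\vartheta(v;\tau)}\sum_{n\in\mathbb Z}\frac{(-1)^ne^{\pi in(n+1)\tau+2\pi inv}}{1-e^{2\pi in\tau+2\pi iu}}\quad(u,v\notin\mathbb Z+\tau\mathbb Z),$$ $$E(x)=2\int_0^xe^{-\pi w^2}\,dw,\qquad R(u;\tau)=\sum_{n\in\mathbb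 Z+\frac12}\Bigl(\operatorname{sgn}(n)-E\bigl((n+\tfrac{\operatorname{Im}u}{\operatorname{Im}\tau})\sqrt{2\operatorname{Im}\tau}\bigr)\Bigr)(-1)^{n-\frac12}e^{-\pi in^2\tau-2\pi inu},$$ $$\tilde\mu(u,v;\tau)=\mu(u,v;\tau)+\tfrac i2R(u-v;\tau),\qquad g_{a,b}(\tau)=\sum_{n\in\mathbb Z+a}n\,e^{\pi in^2\tau+2\pi inb}\quad(a,b\in\mathbb R).$$ Let $a$ and $c$ be integers with $c>0$ and $c\nmid 2a$. Then for every $\tau\in\mathcal H$ the outer series (over $n$) defining $\mathcal O(\zeta_c^a;\tau)$ and the integral below converge absolutely, and $$\mathcal O(\zeta_c^a;\tau)=\frac{2\zeta_c^a(1-\zeta_c^a)}{1+\zeta_c^a}P(a,c;\tau)-\frac{2i\zeta_c^a(1-\zeta_c^a)}{1+\zeta_c^a}N(a,c;\tau)+i\sqrt2\,\frac{1-\zeta_c^a}{1+\zeta_c^a}\int_{-\overline\tau}^{i\infty}\frac{g_{0,\frac12-\frac{2a}c}(2z)}{\sqrt{-i(z+\tau)}}\,dz,$$ where $$N(a,c;\tau)=q^{-\frac14}\tilde\mu\bigl(\tfrac{2a}c,\tau;2\tau\bigr),\qquad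 P(a,c;\tau)=\frac{(-q;q)_\infty\,(q^2;q^2)_\infty^2}{(q;q)_\infty\,[\zeta_c^{2a};q^2]_\infty},$$ the integral is taken along the vertical ray from $-\overline\tau$ upwards, and the square root is the principal one. -/

import Mathlib

namespace OverpartitionRank

open Complex

/-- An overpartition of `n`: a partition of `n` together with the set of those part sizes whose
first appearance is overlined. -/
@[ext]
structure Overpartition (n : ℕ) where
  toPartition : n.Partition
  overlined : Finset ℕ
  overlined_subset : overlined ⊆ toPartition.parts.toFinset

/-- There are finitely many overpartitions of `n`, so that counting them by `Nat.card` is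
meaningful. -/
instance (n : ℕ) : Finite (Overpartition n) :=
  Finite.of_injective
    (fun π : Overpartition n =>
      (⟨π.toPartition, ⟨π.overlined, Finset.mem_powerset.2 π.overlined_subset⟩⟩ :
        Σ p : n.Partition, {S : Finset ℕ // S ∈ p.parts.toFinset.powerset}))
    (by
      rintro ⟨p, S, hS⟩ ⟨p', S', hS'⟩ h
      obtain ⟨rfl, h⟩ := Sigma.mk.inj_iff.1 h
      have h := congrArg Subtype.val (eq_of_heq h)
      simp only at h
      subst h
      rfl)

/-- The Dyson rank: the largest part minus the number of parts (`0` for the empty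
overpartition). -/
def Overpartition.rank {n : ℕ} (π : Overpartition n) : ℤ :=
  (π.toPartition.parts.sup : ℤ) - (Multiset.card π.toPartition.parts : ℤ)

/-- The number of overpartitions of `n` with rank `m`. -/
noncomputable def rankCount (m : ℤ) (n : ℕ) : ℕ :=
  Nat.card {π : Overpartition n // π.rank = m}

/-- The nome `q = exp (2 π i τ)`. -/
noncomputable def nome (τ : ℂ) : ℂ :=
  cexp (2 * Real.pi * I * τ)

/-- The coefficient of `q ^ n` in the overpartition rank function, `∑ₘ N(m, n) zᵐ`; only finitely
many terms are nonzero. -/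
noncomputable def rankCoeff (z : ℂ) (n : ℕ) : ℂ :=
  ∑' m : ℤ, (rankCount m n : ℂ) * z ^ m

/-- The overpartition rank function `𝒪(z; τ) = ∑ₙ ∑ₘ N(m, n) zᵐ qⁿ`. -/
noncomputable def rankFunction (z τ : ℂ) : ℂ :=
  ∑' n : ℕ, rankCoeff z n * nome τ ^ n

/-- The infinite product `(z; q)_∞ = ∏_{j ≥ 0} (1 - z qʲ)`. -/
noncomputable def qProd (z q : ℂ) : ℂ :=
  ∏' j : ℕ, (1 - z * q ^ j)

/-- The product `[z; q]_∞ = (z; q)_∞ (q / z; q)_∞`. -/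
noncomputable def jacProd (z q : ℂ) : ℂ :=
  qProd z q * qProd (q / z) q

/-- The theta function `ϑ(z; τ) = ∑_{n ∈ ℤ + 1/2} exp (π i n² τ + 2 π i n (z + 1/2))`. -/
noncomputable def vartheta (z τ : ℂ) : ℂ :=
  ∑' k : ℤ, cexp (Real.pi * I * (k + 1 / 2) ^ 2 * τ
    + 2 * Real.pi * I * (k + 1 / 2) * (z + 1 / 2))

/-- The Appell–Lerch sum `μ(u, v; τ)`. -/
noncomputable def mu (u v τ : ℂ) : ℂ :=
  cexp (Real.pi * I * u) / vartheta v τ *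
    ∑' n : ℤ, (-1) ^ n * cexp (Real.pi * I * n * (n + 1) * τ + 2 * Real.pi * I * n * v) /
      (1 - cexp (2 * Real.pi * I * n * τ + 2 * Real.pi * I * u))

/-- The error function `E(x) = 2 ∫₀ˣ exp (-π w²) dw`, which is only needed at real arguments. -/
noncomputable def errorE (x : ℝ) : ℝ :=
  2 * ∫ w in (0 : ℝ)..x, Real.exp (-Real.pi * w ^ 2)

/-- The function
`R(u; τ) = ∑_{n ∈ ℤ + 1/2} (sgn n - E((n + a) √(2y))) (-1)^{n - 1/2} exp (-π i n² τ - 2 π i n u)`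
with `y = Im τ` and `a = Im u / Im τ`, written with `n = k + 1/2`. -/
noncomputable def zwegersR (u τ : ℂ) : ℂ :=
  ∑' k : ℤ,
    ((Real.sign ((k : ℝ) + 1 / 2)
        - errorE (((k : ℝ) + 1 / 2 + u.im / τ.im) * Real.sqrt (2 * τ.im)) : ℝ) : ℂ)
      * (-1) ^ k
      * cexp (-Real.pi * I * (k + 1 / 2) ^ 2 * τ - 2 * Real.pi * I * (k + 1 / 2) * u)

/-- The completed function `μ̃(u, v; τ) = μ(u, v; τ) + (i / 2) R(u - v; τ)`. -/
noncomputable def muTilde (u v τ : ℂ) : ℂ :=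
  mu u v τ + I / 2 * zwegersR (u - v) τ

/-- The unary theta function `g_{a,b}(τ) = ∑_{n ∈ ℤ + a} n exp (π i n² τ + 2 π i n b)`. -/
noncomputable def unaryTheta (a b : ℝ) (τ : ℂ) : ℂ :=
  ∑' k : ℤ, ((k : ℂ) + a) * cexp (Real.pi * I * ((k : ℂ) + a) ^ 2 * τ
    + 2 * Real.pi * I * ((k : ℂ) + a) * b)

/-- Absolute convergence of `∫_w^{i∞} f(z) dz` along the vertical ray `z = w + i t`, `t > 0`. -/
def IntegrableToIInfty (f : ℂ → ℂ) (w : ℂ) : Prop :=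
  MeasureTheory.IntegrableOn (fun t : ℝ => f (w + I * t)) (Set.Ioi 0)

/-- The integral `∫_w^{i∞} f(z) dz` along the vertical ray `z = w + i t`, `t > 0`. -/
noncomputable def integralToIInfty (f : ℂ → ℂ) (w : ℂ) : ℂ :=
  I * ∫ t in Set.Ioi (0 : ℝ), f (w + I * t)

/-- The root of unity `ζ_c = exp (2 π i / c)`. -/
noncomputable def zeta (c : ℤ) : ℂ :=
  cexp (2 * Real.pi * I / c)

/-- `N(a, c; τ) = q^{-1/4} μ̃(2a/c, τ; 2τ)`, where `q^{-1/4} = exp (-π i τ / 2)`. -/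
noncomputable def completedN (a c : ℤ) (τ : ℂ) : ℂ :=
  cexp (2 * Real.pi * I * τ * (-1 / 4)) * muTilde (2 * a / c) τ (2 * τ)

/-- `P(a, c; τ) = (-q; q)_∞ (q²; q²)_∞² / ((q; q)_∞ [ζ_c^{2a}; q²]_∞)`. -/
noncomputable def productP (a c : ℤ) (τ : ℂ) : ℂ :=
  qProd (-nome τ) (nome τ) * qProd (nome τ ^ 2) (nome τ ^ 2) ^ 2 /
    (qProd (nome τ) (nome τ) * jacProd (zeta c ^ (2 * a)) (nome τ ^ 2))

/-- The integrand `z ↦ g_{0, 1/2 - 2a/c}(2z) / √(-i (z + τ))`, with the principal square root. -/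
noncomputable def periodIntegrand (a c : ℤ) (τ z : ℂ) : ℂ :=
  unaryTheta 0 (1 / 2 - 2 * a / c) (2 * z) / Complex.sqrt (-I * (z + τ))

end OverpartitionRank

namespace OverpartitionRank

open Complex Filter Topology MeasureTheory

/-! Put `z = ζ_c^a`, so `‖z‖ = 1`, and `q = nome τ`. Sorting overpartitions by largest part turns
`𝒪(z; τ)` into `1 + 2 q * rankSum q z`, a `q`-hypergeometric series in `z` (`rankFunction_hasSum`).

This series is identified with an Appell sum by rigidity. A function holomorphic on the annulus `‖p‖
< ‖z‖ < ‖p‖⁻¹` with `F (z p) = F z` is constant on the unit circle, and one with `F (z p) = z F z`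
vanishes there; both follow from the recurrence that the equation imposes on Laurent coefficients. A
first-order `q`-difference equation for `rankSum`, matched with one for `appell q q`, makes the
difference of the two sides, multiplied by a theta product, quasiperiodic
(`thetaSum_mul_rankSum_eq`). At `z = 1` this gives Gauss's product for `∑ (-1)ⁿ q^{n²}`, and hence
`𝒪` is an explicit multiple of `appell q q z` plus `(1 - z) / (1 + z)` (`one_add_rankSum_eq`).

Writing `1 / (1 - z qⁿ) = (1 + z qⁿ) / (1 - z² q²ⁿ)` splits the Appell sum in two (`appell_eq_add`).
The first piece is a reciprocal theta function by partial fractions (`appell_sq_mul_jacProd`) and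
produces `P`; the second is `μ(2a/c, τ; 2τ)`.

It remains to see that the completion is compensated. At `u = 2a/c - τ` and modulus `2τ` the
half-integral sum `R` becomes a sum over integers `k`. Its term `k = 0` contributes the constant
that accounts for `(1 - z) / (1 + z)`; the terms `k ≠ 0` are, by writing `sgn - E` as the integral
of a Gaussian, the period integral of the unary theta function (`zwegersR_eq`). -/

/-! ### Laurent coefficients on an annulus and rigidity of (quasi)periodic functions -/

/-- The open annulus `‖p‖ < ‖z‖ < ‖p‖⁻¹`. -/
def annulus (p : ℂ) : Set ℂ := {z | ‖p‖ < ‖z‖ ∧ ‖z‖ < ‖p‖⁻¹}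

lemma isOpen_annulus (p : ℂ) : IsOpen (annulus p) :=
  (isOpen_lt continuous_const continuous_norm).inter (isOpen_lt continuous_norm continuous_const)

lemma ne_zero_of_mem_annulus {p z : ℂ} (hz : z ∈ annulus p) : z ≠ 0 :=
  norm_pos_iff.1 ((norm_nonneg p).trans_lt hz.1)

lemma mem_annulus_of_norm_eq_one {p z : ℂ} (hp0 : p ≠ 0) (hp : ‖p‖ < 1) (hz : ‖z‖ = 1) :
    z ∈ annulus p :=
  ⟨hz ▸ hp, hz ▸ (one_lt_inv₀ (norm_pos_iff.2 hp0)).2 hp⟩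

/-- `2π` times the `m`-th Laurent coefficient of `F`, computed on the circle of radius `R`. -/
noncomputable def laurentCoeff (F : ℂ → ℂ) (R : ℝ) (m : ℤ) : ℂ :=
  ∫ θ in (0 : ℝ)..2 * Real.pi, circleMap 0 R θ ^ (-m) * F (circleMap 0 R θ)

lemma laurentCoeff_eq_circleIntegral (F : ℂ → ℂ) {R : ℝ} (hR : 0 < R) (m : ℤ) :
    I * laurentCoeff F R m = ∮ z in C(0, R), (z - 0)⁻¹ • (z ^ (-m) * F z) := by
  rw [laurentCoeff, ← intervalIntegral.integral_const_mul, circleIntegral]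
  refine intervalIntegral.integral_congr fun θ _ => ?_
  have : circleMap 0 R θ ≠ 0 := circleMap_ne_center hR.ne'
  simp only [deriv_circleMap, smul_eq_mul, sub_zero]
  field_simp

/-- Cauchy's theorem between the two circles. -/
lemma laurentCoeff_eq_of_lt {p : ℂ} {F : ℂ → ℂ} (hF : DifferentiableOn ℂ F (annulus p))
    {r R : ℝ} (hr : ‖p‖ < r) (hrR : r ≤ R) (hR : R < ‖p‖⁻¹) (m : ℤ) :
    laurentCoeff F R m = laurentCoeff F r m := by
  have hr0 : 0 < r := (norm_nonneg p).trans_lt hr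
  have hsub : Metric.closedBall (0 : ℂ) R \ Metric.ball 0 r ⊆ annulus p := by
    rintro z ⟨h1, h2⟩
    simp only [Metric.mem_closedBall, dist_zero_right, Metric.mem_ball, not_lt] at h1 h2
    exact ⟨hr.trans_le h2, h1.trans_lt hR⟩
  have hd : DifferentiableOn ℂ (fun z => z ^ (-m) * F z) (annulus p) := fun z hz =>
    ((differentiableAt_zpow.2 (Or.inl (ne_zero_of_mem_annulus hz))).differentiableWithinAt).mul
      (hF z hz)
  refine mul_left_cancel₀ I_ne_zero ?_
  rw [laurentCoeff_eq_circleIntegral F (hr0.trans_le hrR), laurentCoeff_eq_circleIntegral F hr0]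
  refine circleIntegral_sub_center_inv_smul_eq_of_differentiable_on_annulus_off_countable
    (s := ∅) hr0 hrR Set.countable_empty (hd.continuousOn.mono hsub) fun z hz => ?_
  refine hd.differentiableAt ((isOpen_annulus p).mem_nhds (hsub ⟨?_, ?_⟩))
  · exact Metric.ball_subset_closedBall hz.1.1
  · exact fun h => hz.1.2 (Metric.ball_subset_closedBall h)

lemma circleMap_mul_arg (p : ℂ) (R θ : ℝ) :
    circleMap 0 (‖p‖ * R) (θ + p.arg) = circleMap 0 R θ * p := by
  simp only [circleMap, zero_add]
  conv_rhs => rw [← norm_mul_exp_arg_mul_I p]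
  push_cast
  rw [add_mul, Complex.exp_add]
  ring

/-- Substitute `z ↦ z p` in the integral. Since `p` is complex, this scales the radius by `‖p‖` and
rotates the circle by `arg p`; the rotation is harmless because the integrand is `2π`-periodic in
the angle. -/
lemma laurentCoeff_mul_pow {p : ℂ} (hp0 : p ≠ 0) {F : ℂ → ℂ} {k : ℕ}
    (hfe : ∀ z : ℂ, 1 < ‖z‖ → ‖z‖ < ‖p‖⁻¹ → F (z * p) = z ^ k * F z) {R : ℝ} (h1 : 1 < R)
    (hR : R < ‖p‖⁻¹) (m : ℤ) :
    p ^ m * laurentCoeff F (‖p‖ * R) m = laurentCoeff F R (m - k) := by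
  have hR0 : 0 < R := one_pos.trans h1
  have hper : Function.Periodic (fun θ : ℝ => circleMap 0 (‖p‖ * R) θ ^ (-m)
      * F (circleMap 0 (‖p‖ * R) θ)) (2 * Real.pi) := fun θ => by
    simp only [periodic_circleMap 0 (‖p‖ * R) θ]
  have h := hper.intervalIntegral_add_eq p.arg 0
  rw [zero_add] at h
  have hshift := intervalIntegral.integral_comp_add_right (a := 0) (b := 2 * Real.pi)
    (fun θ : ℝ => circleMap 0 (‖p‖ * R) θ ^ (-m) * F (circleMap 0 (‖p‖ * R) θ)) p.arg
  rw [zero_add, add_comm (2 * Real.pi), h] at hshift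
  rw [laurentCoeff, ← hshift, ← intervalIntegral.integral_const_mul, laurentCoeff]
  refine intervalIntegral.integral_congr fun θ _ => ?_
  have hz : circleMap 0 R θ ≠ 0 := circleMap_ne_center hR0.ne'
  have hn : ‖circleMap 0 R θ‖ = R := by simp [circleMap_zero, abs_of_pos hR0]
  simp only [circleMap_mul_arg]
  rw [hfe _ (by rwa [hn]) (by rwa [hn]), neg_sub, zpow_sub₀ hz, zpow_natCast, mul_zpow, zpow_neg,
    zpow_neg]
  have := zpow_ne_zero m hp0
  have := zpow_ne_zero m hz
  field_simp

/-- The annulus contains circles of radius `R > 1` and `‖p‖ R < 1`, so the previous relation can be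
moved to the unit circle. Asking for the functional equation only when `1 < ‖z‖ < ‖p‖⁻¹` keeps both
`z` and `z p` away from `z = 1`, where the Appell sums have a pole. -/
lemma laurentCoeff_recurrence {p : ℂ} (hp0 : p ≠ 0) (hp : ‖p‖ < 1) {F : ℂ → ℂ}
    (hF : DifferentiableOn ℂ F (annulus p)) {k : ℕ}
    (hfe : ∀ z : ℂ, 1 < ‖z‖ → ‖z‖ < ‖p‖⁻¹ → F (z * p) = z ^ k * F z) (m : ℤ) :
    p ^ m * laurentCoeff F 1 m = laurentCoeff F 1 (m - k) := by
  have hn : 0 < ‖p‖ := norm_pos_iff.2 hp0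
  have hi : 1 < ‖p‖⁻¹ := (one_lt_inv₀ hn).2 hp
  obtain ⟨R, h1, hR⟩ := exists_between hi
  have hRp : ‖p‖ * R < 1 := by
    rwa [lt_inv_comm₀ (by linarith) hn, ← one_div, lt_div_iff₀ (by linarith)] at hR
  rw [← laurentCoeff_eq_of_lt hF hp h1.le hR (m - k), ← laurentCoeff_mul_pow hp0 hfe h1 hR,
    laurentCoeff_eq_of_lt hF (r := ‖p‖ * R) (by nlinarith) hRp.le hi]

lemma norm_laurentCoeff_le {p : ℂ} (hp0 : p ≠ 0) (hp : ‖p‖ < 1) {F : ℂ → ℂ}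
    (hF : DifferentiableOn ℂ F (annulus p)) : ∃ C : ℝ, ∀ m, ‖laurentCoeff F 1 m‖ ≤ C := by
  obtain ⟨C, hC⟩ := (isCompact_sphere (0 : ℂ) 1).exists_bound_of_continuousOn
    (hF.continuousOn.mono fun z hz => mem_annulus_of_norm_eq_one hp0 hp (by simpa using hz))
  refine ⟨C * |2 * Real.pi - 0|, fun m => intervalIntegral.norm_integral_le_of_norm_le_const
    fun θ _ => ?_⟩
  have hn : ‖circleMap 0 1 θ‖ = 1 := by simp
  rw [norm_mul, norm_zpow, hn, one_zpow, one_mul]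
  exact hC _ (by simp)

instance fact_two_pi_pos : Fact (0 < 2 * Real.pi) := ⟨Real.two_pi_pos⟩

/-- On the unit circle Laurent coefficients are Fourier coefficients, and a continuous function with
summable Fourier coefficients is the pointwise sum of its Fourier series. -/
lemma eq_of_laurentCoeff_eq_zero {p : ℂ} (hp0 : p ≠ 0) (hp : ‖p‖ < 1) {F : ℂ → ℂ}
    (hF : DifferentiableOn ℂ F (annulus p)) (h : ∀ m ≠ 0, laurentCoeff F 1 m = 0)
    {z : ℂ} (hz : ‖z‖ = 1) : F z = (2 * Real.pi : ℂ)⁻¹ * laurentCoeff F 1 0 := by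
  let f : C(AddCircle (2 * Real.pi), ℂ) :=
    ⟨fun x => F (AddCircle.toCircle x : ℂ), by
      refine hF.continuousOn.comp_continuous
        (continuous_subtype_val.comp AddCircle.continuous_toCircle) fun x => ?_
      exact mem_annulus_of_norm_eq_one hp0 hp (Circle.norm_coe _)⟩
  have hcoe (x : ℝ) : ((AddCircle.toCircle (x : AddCircle (2 * Real.pi)) : Circle) : ℂ)
      = circleMap 0 1 x := by
    rw [AddCircle.toCircle_apply_mk, Circle.coe_exp, circleMap]
    simp
  have hcoeff (m : ℤ) : fourierCoeff f m = (2 * Real.pi : ℂ)⁻¹ * laurentCoeff F 1 m := by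
    rw [fourierCoeff_eq_intervalIntegral f m 0, zero_add, laurentCoeff, real_smul]
    push_cast
    rw [one_div]
    congr 1
    refine intervalIntegral.integral_congr fun θ _ => ?_
    simp only [f, ContinuousMap.coe_mk, smul_eq_mul, hcoe, fourier_apply, AddCircle.toCircle_zsmul,
      Circle.coe_zpow]
  have hzero : ∀ m ≠ 0, fourierCoeff f m = 0 := fun m hm => by rw [hcoeff, h m hm, mul_zero]
  have hs := has_pointwise_sum_fourier_series_of_summable
    (summable_of_ne_finset_zero (s := {0}) fun m hm => hzero m (by simpa using hm))
    ((z.arg : ℝ) : AddCircle (2 * Real.pi))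
  have hs' := hasSum_single (f := fun i => fourierCoeff f i • fourier i
    ((z.arg : ℝ) : AddCircle (2 * Real.pi))) 0 fun m hm => by rw [hzero m hm, zero_smul]
  have := hs.unique hs'
  rw [hcoeff] at this
  have hzc : circleMap 0 1 z.arg = z := by
    rw [circleMap, zero_add, ← hz, norm_mul_exp_arg_mul_I]
  simpa [f, hcoe, hzc] using this

/-- A holomorphic function on the annulus with `F (z p) = F z` is constant on the unit circle. -/
lemma eq_one_of_periodic {p : ℂ} (hp0 : p ≠ 0) (hp : ‖p‖ < 1) {F : ℂ → ℂ}
    (hF : DifferentiableOn ℂ F (annulus p))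
    (hfe : ∀ z : ℂ, 1 < ‖z‖ → ‖z‖ < ‖p‖⁻¹ → F (z * p) = F z) {z : ℂ} (hz : ‖z‖ = 1) :
    F z = F 1 := by
  have h : ∀ m ≠ 0, laurentCoeff F 1 m = 0 := fun m hm => by
    have h1 := laurentCoeff_recurrence hp0 hp hF (k := 0) (by simpa using hfe) m
    have h2 : p ^ m ≠ 1 := fun h => by
      have := congrArg norm h
      rw [norm_zpow, norm_one, zpow_eq_one_iff_right₀ (norm_nonneg p) hp.ne] at this
      exact hm this
    have h3 : (p ^ m - 1) * laurentCoeff F 1 m = 0 := by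
      rw [sub_mul, h1]; simp
    exact (mul_eq_zero.1 h3).resolve_left (sub_ne_zero.2 h2)
  rw [eq_of_laurentCoeff_eq_zero hp0 hp hF h hz, eq_of_laurentCoeff_eq_zero hp0 hp hF h norm_one]

/-- A holomorphic function on the annulus with `F (z p) = z F z` vanishes on the unit circle. -/
lemma eq_zero_of_quasiperiodic {p : ℂ} (hp0 : p ≠ 0) (hp : ‖p‖ < 1) {F : ℂ → ℂ}
    (hF : DifferentiableOn ℂ F (annulus p))
    (hfe : ∀ z : ℂ, 1 < ‖z‖ → ‖z‖ < ‖p‖⁻¹ → F (z * p) = z * F z) {z : ℂ} (hz : ‖z‖ = 1) :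
    F z = 0 := by
  have hrec (m : ℤ) : laurentCoeff F 1 m = p ^ (m + 1) * laurentCoeff F 1 (m + 1) := by
    simpa using (laurentCoeff_recurrence hp0 hp hF (k := 1) (by simpa using hfe) (m + 1)).symm
  obtain ⟨C, hC⟩ := norm_laurentCoeff_le hp0 hp hF
  -- For `m ≥ 0` the factor `p ^ (m + 1)` contracts, so iterating the recurrence upwards from the
  -- uniform bound `C` forces the coefficient to be zero.
  have hnat (j : ℕ) : ∀ m : ℕ, ‖laurentCoeff F 1 m‖ ≤ ‖p‖ ^ j * C := by
    induction j with
    | zero => intro m; simpa using hC m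
    | succ j ih =>
      intro m
      rw [hrec, norm_mul, norm_zpow, pow_succ, mul_assoc, mul_left_comm]
      have h1 : ‖p‖ ^ ((m : ℤ) + 1) ≤ ‖p‖ := by
        have := pow_le_of_le_one (norm_nonneg p) hp.le (n := m + 1) (by simp)
        exact_mod_cast this
      have h2 := ih (m + 1)
      push_cast at h2
      have h3 : 0 ≤ ‖p‖ ^ j * C := (norm_nonneg _).trans h2
      calc _ ≤ ‖p‖ * (‖p‖ ^ j * C) := mul_le_mul h1 h2 (norm_nonneg _) (norm_nonneg _)
        _ = _ := by ring
  have hpos (m : ℕ) : laurentCoeff F 1 m = 0 := by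
    have ht : Tendsto (fun j : ℕ => ‖p‖ ^ j * C) atTop (𝓝 (0 * C)) :=
      (tendsto_pow_atTop_nhds_zero_of_lt_one (norm_nonneg p) hp).mul_const C
    rw [zero_mul] at ht
    exact norm_le_zero_iff.1 (ge_of_tendsto' ht fun j => hnat j m)
  -- For negative indices the factor no longer contracts, but the recurrence carries the vanishing
  -- at `0` downwards.
  have hneg (m : ℕ) : laurentCoeff F 1 (-(m : ℤ)) = 0 := by
    induction m with
    | zero => simpa using hpos 0
    | succ m ih =>
      rw [hrec]
      push_cast
      rw [neg_add_rev, neg_add_cancel_comm, ih, mul_zero]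
  have hall (m : ℤ) : laurentCoeff F 1 m = 0 := by
    obtain ⟨n, rfl | rfl⟩ := m.eq_nat_or_neg
    exacts [hpos n, hneg n]
  rw [eq_of_laurentCoeff_eq_zero hp0 hp hF (fun m _ => hall m) hz, hall, mul_zero]

/-! ### Appell sums: convergence, holomorphy, functional equations -/

lemma summable_abs_pow_mul_zpow {r : ℝ} (h0 : 0 < r) (h1 : r < 1) (k : ℕ) (b : ℤ) :
    Summable fun n : ℤ => (|n| ^ k : ℝ) * r ^ (n * n + b * n) := by
  have hlog : Real.log r < 0 := Real.log_neg h0 h1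
  -- The parameters are chosen so that the majorant is `r ^ (n² - |b| |n|)`.
  have h := summable_pow_mul_jacobiTheta₂_term_bound (|b| * (-Real.log r) / (2 * Real.pi))
    (T := -Real.log r / Real.pi) (by positivity [neg_pos.2 hlog, Real.pi_pos]) k
  refine Summable.of_nonneg_of_le (fun n => by positivity) (fun n => ?_) h
  push_cast
  refine mul_le_mul_of_nonneg_left ?_ (by positivity)
  rw [← Real.rpow_intCast, Real.rpow_def_of_pos h0, Real.exp_le_exp]
  push_cast
  have h2 : -(b * n : ℝ) ≤ |(b : ℝ)| * |(n : ℝ)| := by rw [← abs_mul]; exact neg_le_abs _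
  have h3 : -Real.pi * (-Real.log r / Real.pi * n ^ 2
      - 2 * (|(b : ℝ)| * -Real.log r / (2 * Real.pi)) * |(n : ℝ)|)
      = Real.log r * (n ^ 2 - |(b : ℝ)| * |(n : ℝ)|) := by
    field_simp
    ring
  rw [h3]
  nlinarith

lemma summable_neg_one_zpow_mul_zpow {q : ℂ} (h0 : q ≠ 0) (h1 : ‖q‖ < 1) (b : ℤ) :
    Summable fun n : ℤ => ‖(-1 : ℂ) ^ n * q ^ (n * n + b * n)‖ := by
  simpa using summable_abs_pow_mul_zpow (norm_pos_iff.2 h0) h1 0 b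

/-- A bound uniform in `n ≠ 0` and in `z` on a smaller annulus, so that the coefficients alone
control the Appell sums. The index `n = 0` is left out because its denominator vanishes at `z = 1`.
-/
lemma le_norm_one_sub_mul_zpow {p z : ℂ} {s : ℝ} (hp0 : p ≠ 0) (hp : ‖p‖ < 1) (hs : ‖p‖ < s)
    (hz1 : s < ‖z‖) (hz2 : ‖z‖ < s⁻¹) {n : ℤ} (hn : n ≠ 0) :
    1 - ‖p‖ / s ≤ ‖1 - z * p ^ n‖ := by
  have hp' : 0 < ‖p‖ := norm_pos_iff.2 hp0
  have hs0 : 0 < s := hp'.trans hs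
  rcases lt_or_gt_of_ne hn with h | h
  · have h1 : ‖p‖⁻¹ ≤ ‖p‖ ^ n := by
      rw [← zpow_neg_one]
      exact zpow_le_zpow_right_of_le_one₀ hp' hp.le (by omega)
    have h2 : s / ‖p‖ ≤ ‖z * p ^ n‖ := by
      rw [norm_mul, norm_zpow, div_eq_mul_inv]
      exact mul_le_mul hz1.le h1 (by positivity) (norm_nonneg _)
    have h3 := norm_sub_norm_le (z * p ^ n) 1
    rw [norm_sub_rev, norm_one] at h3
    -- By AM-GM, `s / ‖p‖ - 1 ≥ 1 - ‖p‖ / s`, so one constant serves both signs of `n`.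
    have h4 : 2 ≤ s / ‖p‖ + ‖p‖ / s := by
      rw [div_add_div _ _ hp'.ne' hs0.ne', le_div_iff₀ (by positivity)]
      nlinarith [sq_nonneg (s - ‖p‖)]
    linarith
  · have h1 : ‖p‖ ^ n ≤ ‖p‖ := by
      conv_rhs => rw [← zpow_one ‖p‖]
      exact zpow_le_zpow_right_of_le_one₀ hp' hp.le (by omega)
    have h2 : ‖z * p ^ n‖ ≤ ‖p‖ / s := by
      rw [norm_mul, norm_zpow, div_eq_mul_inv, mul_comm]
      exact mul_le_mul h1 hz2.le (norm_nonneg _) hp'.le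
    have h3 := norm_sub_norm_le 1 (z * p ^ n)
    rw [norm_one] at h3
    linarith

lemma exists_between_annulus {p z : ℂ} (hp : ‖p‖ < 1) (hz : z ∈ annulus p) :
    ∃ s : ℝ, ‖p‖ < s ∧ s < 1 ∧ s < ‖z‖ ∧ ‖z‖ < s⁻¹ := by
  have hz0 : 0 < ‖z‖ := norm_pos_iff.2 (ne_zero_of_mem_annulus hz)
  have hzi : ‖p‖ < ‖z‖⁻¹ := by
    rcases (norm_nonneg p).eq_or_lt with h | h
    · rw [← h]; positivity
    · rw [lt_inv_comm₀ h hz0]; exact hz.2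
  obtain ⟨s, h1, h2⟩ := exists_between (lt_min hp (lt_min hz.1 hzi))
  have hs0 : 0 < s := (norm_nonneg p).trans_lt h1
  simp only [lt_min_iff] at h2
  exact ⟨s, h1, h2.1, h2.2.1, by rw [lt_inv_comm₀ hz0 hs0]; exact h2.2.2⟩

lemma one_sub_mul_zpow_ne_zero {p z : ℂ} (hp0 : p ≠ 0) (hp : ‖p‖ < 1) (hz : z ∈ annulus p)
    {n : ℤ} (hn : n ≠ 0) : 1 - z * p ^ n ≠ 0 := by
  obtain ⟨s, h1, -, h3, h4⟩ := exists_between_annulus hp hz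
  have hs0 : 0 < s := (norm_nonneg p).trans_lt h1
  have h := le_norm_one_sub_mul_zpow hp0 hp h1 h3 h4 hn
  have : ‖p‖ / s < 1 := (div_lt_one hs0).2 h1
  exact norm_pos_iff.1 (by linarith)

lemma summable_div_one_sub {p z : ℂ} (hp0 : p ≠ 0) (hp : ‖p‖ < 1) (hz : z ∈ annulus p)
    {a : ℤ → ℂ} (ha : Summable fun n => ‖a n‖) : Summable fun n : ℤ => a n / (1 - z * p ^ n) := by
  obtain ⟨s, h1, -, h3, h4⟩ := exists_between_annulus hp hz
  have hs0 : 0 < s := (norm_nonneg p).trans_lt h1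
  have hd : 0 < 1 - ‖p‖ / s := sub_pos.2 ((div_lt_one hs0).2 h1)
  refine (ha.div_const (1 - ‖p‖ / s)).of_norm_bounded_eventually ?_
  filter_upwards [(Set.finite_singleton (0 : ℤ)).compl_mem_cofinite] with n hn
  rw [norm_div]
  exact div_le_div_of_nonneg_left (norm_nonneg _) hd
    (le_norm_one_sub_mul_zpow hp0 hp h1 h3 h4 (by simpa using hn))

/-- The Appell sum `∑ₙ (-1)ⁿ q^{n(n+1)} / (1 - z pⁿ)`. -/
noncomputable def appell (q p z : ℂ) : ℂ :=
  ∑' n : ℤ, (-1) ^ n * q ^ (n * n + n) / (1 - z * p ^ n)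

/-- The function `(1 - z) appell q p z` with its singularity at `z = 1` removed. -/
noncomputable def appellReg (q p z : ℂ) : ℂ :=
  1 + (1 - z) * ∑' n : ℤ, if n = 0 then 0 else (-1) ^ n * q ^ (n * n + n) / (1 - z * p ^ n)

lemma summable_appell_coeff {q : ℂ} (hq0 : q ≠ 0) (hq : ‖q‖ < 1) :
    Summable fun n : ℤ => ‖(-1 : ℂ) ^ n * q ^ (n * n + n)‖ := by
  simpa using summable_neg_one_zpow_mul_zpow hq0 hq 1

lemma appellReg_one (q p : ℂ) : appellReg q p 1 = 1 := by simp [appellReg]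

lemma appellReg_eq {q p z : ℂ} (hq0 : q ≠ 0) (hq : ‖q‖ < 1) (hp0 : p ≠ 0) (hp : ‖p‖ < 1)
    (hz : z ∈ annulus p) (hz1 : z ≠ 1) : appellReg q p z = (1 - z) * appell q p z := by
  have hs := summable_div_one_sub hp0 hp hz (summable_appell_coeff hq0 hq)
  rw [appell, hs.tsum_eq_add_tsum_ite 0, appellReg, mul_add]
  have : 1 - z ≠ 0 := sub_ne_zero.2 hz1.symm
  simp [this]

lemma differentiableOn_appellReg {q p : ℂ} (hq0 : q ≠ 0) (hq : ‖q‖ < 1) (hp0 : p ≠ 0)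
    (hp : ‖p‖ < 1) : DifferentiableOn ℂ (appellReg q p) (annulus p) := by
  intro z hz
  obtain ⟨s, h1, -, h3, h4⟩ := exists_between_annulus hp hz
  have hs0 : 0 < s := (norm_nonneg p).trans_lt h1
  have hd : 0 < 1 - ‖p‖ / s := sub_pos.2 ((div_lt_one hs0).2 h1)
  let U : Set ℂ := {z | s < ‖z‖ ∧ ‖z‖ < s⁻¹}
  have hU : IsOpen U := (isOpen_lt continuous_const continuous_norm).inter
    (isOpen_lt continuous_norm continuous_const)
  have hsum : DifferentiableOn ℂ (fun z => ∑' n : ℤ, if n = 0 then 0 else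
      (-1) ^ n * q ^ (n * n + n) / (1 - z * p ^ n)) U := by
    refine differentiableOn_tsum_of_summable_norm
      ((summable_appell_coeff hq0 hq).div_const (1 - ‖p‖ / s)) (fun n => ?_) hU fun n w hw => ?_
    · by_cases hn : n = 0
      · simp [hn]
      · simp only [hn, if_false]
        refine fun w hw => ((differentiableAt_const _).div (by fun_prop) ?_).differentiableWithinAt
        have := le_norm_one_sub_mul_zpow hp0 hp h1 hw.1 hw.2 hn
        exact norm_pos_iff.1 (by linarith)
    · by_cases hn : n = 0
      · simp only [hn, if_true, norm_zero]
        positivity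
      · simp only [hn, if_false, norm_div]
        exact div_le_div_of_nonneg_left (norm_nonneg _) hd
          (le_norm_one_sub_mul_zpow hp0 hp h1 hw.1 hw.2 hn)
  have := hsum.differentiableAt (hU.mem_nhds (⟨h3, h4⟩ : z ∈ U))
  exact ((differentiableAt_const _).add (((differentiableAt_const _).sub differentiableAt_id).mul
    this)).differentiableWithinAt

lemma mul_mem_annulus {p z : ℂ} (hp0 : p ≠ 0) (hp : ‖p‖ < 1) (h1 : 1 < ‖z‖) (h2 : ‖z‖ < ‖p‖⁻¹) :
    z ∈ annulus p ∧ z * p ∈ annulus p ∧ z ≠ 1 ∧ z * p ≠ 1 := by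
  have hp' : 0 < ‖p‖ := norm_pos_iff.2 hp0
  have h3 : ‖z * p‖ < 1 := by
    rw [norm_mul]; rwa [← one_div, lt_div_iff₀ hp'] at h2
  refine ⟨⟨hp.trans h1, h2⟩, ⟨?_, h3.trans ((one_lt_inv₀ hp').2 hp)⟩, ?_, ?_⟩
  · rw [norm_mul]; nlinarith
  · rintro rfl; simp at h1
  · intro h; rw [h] at h3; simp at h3

/-- Shift `n` by one. -/
lemma appell_mul_self {q p z : ℂ} (hp0 : p ≠ 0) :
    appell q p (z * p) =
      ∑' n : ℤ, -((-1) ^ n * q ^ (n * n - n) / (1 - z * p ^ n)) := by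
  rw [appell, ← (Equiv.addRight (1 : ℤ)).tsum_eq
    (fun n : ℤ => -((-1) ^ n * q ^ (n * n - n) / (1 - z * p ^ n)))]
  refine tsum_congr fun n => ?_
  simp only [Equiv.coe_addRight]
  rw [zpow_add₀ (neg_ne_zero.2 one_ne_zero) n 1, zpow_add₀ hp0, zpow_one, zpow_one,
    show (n + 1) * (n + 1) - (n + 1) = n * n + n by ring]
  rw [show z * (p ^ n * p) = z * p * p ^ n by ring]
  ring

/-- The reflection `n ↦ 1 - n` fixes `n² - n` and flips the sign. -/
lemma tsum_neg_one_zpow_mul_zpow_sub (q : ℂ) :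
    ∑' n : ℤ, (-1 : ℂ) ^ n * q ^ (n * n - n) = 0 := by
  have h : ∑' n : ℤ, (-1 : ℂ) ^ n * q ^ (n * n - n)
      = ∑' n : ℤ, -((-1 : ℂ) ^ n * q ^ (n * n - n)) := by
    rw [← (Equiv.subLeft (1 : ℤ)).tsum_eq (fun n : ℤ => (-1 : ℂ) ^ n * q ^ (n * n - n))]
    refine tsum_congr fun n => ?_
    simp only [Equiv.subLeft_apply]
    have h : (-1 : ℂ) ^ n * (-1) ^ n = 1 := by rw [← mul_zpow]; norm_num
    rw [zpow_sub₀ (neg_ne_zero.2 one_ne_zero), zpow_one, div_eq_mul_inv,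
      inv_eq_of_mul_eq_one_right h, show (1 - n) * (1 - n) - (1 - n) = n * n - n by ring]
    ring
  rw [tsum_neg] at h
  linear_combination (1 / 2 : ℂ) * h

lemma summable_neg_one_zpow_mul_zpow_sub {q : ℂ} (h0 : q ≠ 0) (h1 : ‖q‖ < 1) :
    Summable fun n : ℤ => ‖(-1 : ℂ) ^ n * q ^ (n * n - n)‖ := by
  simpa [sub_eq_add_neg] using summable_neg_one_zpow_mul_zpow h0 h1 (-1)

lemma one_sub_mul_zpow_ne_zero' {p z : ℂ} (hp0 : p ≠ 0) (hp : ‖p‖ < 1) (hz : z ∈ annulus p)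
    (hz1 : z ≠ 1) (n : ℤ) : 1 - z * p ^ n ≠ 0 := by
  by_cases hn : n = 0
  · simpa [hn, sub_eq_zero] using hz1.symm
  · exact one_sub_mul_zpow_ne_zero hp0 hp hz hn

/-- With `a = (-1)ⁿ q^{n² - n}` and `x = qⁿ`, the combined term is `-a (1 - z² x²) / (1 - z x) = -a
- z a x`. The denominators cancel, the sum of `a` vanishes, and `a x` gives the theta function. -/
lemma appell_functional_equation {q z : ℂ} (hq0 : q ≠ 0) (hq : ‖q‖ < 1) (h1 : 1 < ‖z‖)
    (h2 : ‖z‖ < ‖q‖⁻¹) :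
    appell q q (z * q) + z ^ 2 * appell q q z = -z * ∑' n : ℤ, (-1) ^ n * q ^ (n * n) := by
  obtain ⟨hz, -, hz1, -⟩ := mul_mem_annulus hq0 hq h1 h2
  have hs0 := summable_neg_one_zpow_mul_zpow_sub hq0 hq
  have hsθ : Summable fun n : ℤ => ‖(-1 : ℂ) ^ n * q ^ (n * n)‖ := by
    simpa using summable_neg_one_zpow_mul_zpow hq0 hq 0
  have hs1 := summable_div_one_sub hq0 hq hz hs0
  have hs2 := summable_div_one_sub hq0 hq hz (summable_appell_coeff hq0 hq)
  rw [appell_mul_self hq0, appell, ← tsum_mul_left, ← hs1.neg.tsum_add (hs2.mul_left _)]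
  have h0 := tsum_neg_one_zpow_mul_zpow_sub q
  have : -z * ∑' n : ℤ, (-1) ^ n * q ^ (n * n)
      = -(∑' n : ℤ, (-1 : ℂ) ^ n * q ^ (n * n - n))
        + -z * ∑' n : ℤ, (-1) ^ n * q ^ (n * n) := by rw [h0]; ring
  rw [this, ← tsum_neg, ← tsum_mul_left, ← hs0.of_norm.neg.tsum_add (hsθ.of_norm.mul_left _)]
  refine tsum_congr fun n => ?_
  have hd := one_sub_mul_zpow_ne_zero' hq0 hq hz hz1 n
  have hn := zpow_ne_zero n hq0
  rw [show n * n + n = (n * n - n) + n + n by ring, zpow_add₀ hq0, zpow_add₀ hq0,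
    show n * n = (n * n - n) + n by ring, zpow_add₀ hq0,
    show n * n - n + n - n = n * n - n by ring]
  field_simp
  ring

/-- Here the combined numerator is a multiple of the denominator itself, so only the vanishing sum
of `(-1)ⁿ q^{n² - n}` remains. -/
lemma appell_sq_functional_equation {q z : ℂ} (hq0 : q ≠ 0) (hq : ‖q‖ < 1) (h1 : 1 < ‖z‖)
    (h2 : ‖z‖ < ‖q ^ 2‖⁻¹) :
    appell q (q ^ 2) (z * q ^ 2) = -z * appell q (q ^ 2) z := by
  have hp0 : q ^ 2 ≠ 0 := pow_ne_zero 2 hq0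
  have hp : ‖q ^ 2‖ < 1 := by rw [norm_pow]; exact pow_lt_one₀ (norm_nonneg _) hq two_ne_zero
  obtain ⟨hz, -, hz1, -⟩ := mul_mem_annulus hp0 hp h1 h2
  have hs0 := summable_neg_one_zpow_mul_zpow_sub hq0 hq
  have hs1 := summable_div_one_sub hp0 hp hz hs0
  have hs2 := summable_div_one_sub hp0 hp hz (summable_appell_coeff hq0 hq)
  rw [← sub_eq_zero, appell_mul_self hp0, appell, ← tsum_mul_left,
    ← hs1.neg.tsum_sub (hs2.mul_left _)]
  have h0 := tsum_neg_one_zpow_mul_zpow_sub q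
  rw [← neg_eq_zero, ← tsum_neg] at h0
  rw [← h0]
  refine tsum_congr fun n => ?_
  have hd := one_sub_mul_zpow_ne_zero' hp0 hp hz hz1 n
  rw [show n * n + n = (n * n - n) + (2 : ℕ) * n by push_cast; ring, zpow_add₀ hq0, zpow_mul,
    zpow_natCast]
  field_simp
  ring

/-! ### Infinite products and the reciprocal theta function -/

lemma summable_norm_mul_pow {q : ℂ} (hq : ‖q‖ < 1) (z : ℂ) :
    Summable fun j : ℕ => ‖-(z * q ^ j)‖ := by
  simpa using (summable_geometric_of_lt_one (norm_nonneg q) hq).mul_left ‖z‖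

lemma multipliable_qProd {q : ℂ} (hq : ‖q‖ < 1) (z : ℂ) :
    Multipliable fun j : ℕ => 1 - z * q ^ j := by
  simpa [sub_eq_add_neg] using multipliable_one_add_of_summable (summable_norm_mul_pow hq z)

lemma qProd_ne_zero {q z : ℂ} (hq : ‖q‖ < 1) (h : ∀ j : ℕ, z * q ^ j ≠ 1) : qProd z q ≠ 0 := by
  have := tprod_one_add_ne_zero_of_summable (f := fun j : ℕ => -(z * q ^ j))
    (fun j => by simpa [← sub_eq_add_neg, sub_eq_zero] using (h j).symm)
    (summable_norm_mul_pow hq z)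
  simpa [qProd, sub_eq_add_neg] using this

lemma qProd_ne_zero_of_norm_lt {q z : ℂ} (hq : ‖q‖ < 1) (hz : ‖z‖ < 1) : qProd z q ≠ 0 := by
  refine qProd_ne_zero hq fun j h => ?_
  have := congrArg norm h
  rw [norm_mul, norm_pow, norm_one] at this
  have h1 : ‖q‖ ^ j ≤ 1 := pow_le_one₀ (norm_nonneg _) hq.le
  nlinarith [norm_nonneg z, pow_nonneg (norm_nonneg q) j]

lemma qProd_eq_mul {q : ℂ} (hq : ‖q‖ < 1) (z : ℂ) : qProd z q = (1 - z) * qProd (z * q) q := by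
  rw [qProd, tprod_eq_zero_mul' (by
    simpa [pow_succ', mul_assoc] using multipliable_qProd hq (z * q))]
  simp [qProd, pow_succ', mul_assoc]

lemma differentiable_qProd {q : ℂ} (hq : ‖q‖ < 1) : Differentiable ℂ fun z => qProd z q := by
  intro z
  have h := Summable.hasProdLocallyUniformlyOn_nat_one_add
    (f := fun (j : ℕ) (w : ℂ) => -(w * q ^ j))
    (K := Metric.ball 0 (‖z‖ + 1)) Metric.isOpen_ball
    ((summable_geometric_of_lt_one (norm_nonneg q) hq).mul_left (‖z‖ + 1))
    (.of_forall fun j w hw => by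
      rw [norm_neg, norm_mul, norm_pow]
      gcongr
      simpa using (Metric.mem_ball.1 hw).le) (fun j => by fun_prop)
  have hd := h.differentiableOn (.of_forall fun s => by
    simpa [Finset.prod_fn] using DifferentiableOn.finsetProd (fun _ _ => by fun_prop))
    Metric.isOpen_ball
  have := hd.differentiableAt (Metric.isOpen_ball.mem_nhds (x := z) (by simp))
  simpa [qProd, sub_eq_add_neg] using this

/-- The theta product `(z p; p)_∞ (p / z; p)_∞`. -/
noncomputable def thetaProd (p z : ℂ) : ℂ := qProd (z * p) p * qProd (p / z) p

lemma jacProd_eq {p : ℂ} (hp : ‖p‖ < 1) (z : ℂ) : jacProd z p = (1 - z) * thetaProd p z := by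
  rw [jacProd, qProd_eq_mul hp, thetaProd, mul_assoc]

lemma differentiableOn_thetaProd {p : ℂ} (hp : ‖p‖ < 1) :
    DifferentiableOn ℂ (thetaProd p) (annulus p) := by
  intro z hz
  have hz0 := ne_zero_of_mem_annulus hz
  have h := differentiable_qProd hp
  exact ((DifferentiableAt.fun_comp' z (h _) (by fun_prop)).mul
    (DifferentiableAt.fun_comp' z (h _) (by fun_prop (disch := assumption)))).differentiableWithinAt

lemma thetaProd_ne_zero {p z : ℂ} (hp : ‖p‖ < 1) (hz : ‖z‖ = 1) : thetaProd p z ≠ 0 :=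
  mul_ne_zero (qProd_ne_zero_of_norm_lt hp (by simpa [hz] using hp))
    (qProd_ne_zero_of_norm_lt hp (by simpa [hz] using hp))

/-- Moving `z` to `z p` shifts one factor from each product; the form without division stays valid
at the zeros. -/
lemma thetaProd_mul_self {p z : ℂ} (hp0 : p ≠ 0) (hp : ‖p‖ < 1) (hz0 : z ≠ 0) :
    z * (1 - z * p) * thetaProd p (z * p) = -(1 - z) * thetaProd p z := by
  rw [thetaProd, thetaProd, qProd_eq_mul hp (z * p), show p / (z * p) = z⁻¹ by field_simp,
    qProd_eq_mul hp z⁻¹, show z⁻¹ * p = p / z by field_simp]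
  field_simp
  ring

/-- The partial fraction expansion of the reciprocal of the theta product. -/
lemma appell_sq_mul_jacProd {q z : ℂ} (hq0 : q ≠ 0) (hq : ‖q‖ < 1) (hz : ‖z‖ = 1) (hz1 : z ≠ 1) :
    appell q (q ^ 2) z * jacProd z (q ^ 2) = qProd (q ^ 2) (q ^ 2) ^ 2 := by
  have hp0 : q ^ 2 ≠ 0 := pow_ne_zero 2 hq0
  have hp : ‖q ^ 2‖ < 1 := by rw [norm_pow]; exact pow_lt_one₀ (norm_nonneg _) hq two_ne_zero
  -- The multipliers of the Appell sum and of the theta product cancel, so their product is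
  -- constant; at `z = 1` it is `(q²; q²)_∞²`.
  have h := eq_one_of_periodic hp0 hp
    ((differentiableOn_appellReg hq0 hq hp0 hp).mul (differentiableOn_thetaProd hp)) ?_ hz
  · simp only [Pi.mul_apply] at h
    rw [appellReg_one, one_mul, appellReg_eq hq0 hq hp0 hp
      (mem_annulus_of_norm_eq_one hp0 hp hz) hz1] at h
    rw [jacProd_eq hp]
    simp only [thetaProd, one_mul, div_one] at h ⊢
    linear_combination h
  · intro w h1 h2
    obtain ⟨hw, hwp, hw1, hwp1⟩ := mul_mem_annulus hp0 hp h1 h2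
    have hw0 := ne_zero_of_mem_annulus hw
    simp only [Pi.mul_apply]
    rw [appellReg_eq hq0 hq hp0 hp hw hw1, appellReg_eq hq0 hq hp0 hp hwp hwp1,
      appell_sq_functional_equation hq0 hq h1 h2]
    have := thetaProd_mul_self hp0 hp hw0
    linear_combination (-appell q (q ^ 2) w) * this

/-! ### The rank generating function as a series and its `q`-difference equation -/

/-- The finite product `(z; q)_n`. -/
noncomputable def qPoch (z q : ℂ) (n : ℕ) : ℂ := ∏ j ∈ Finset.range n, (1 - z * q ^ j)

lemma qPoch_succ (z q : ℂ) (n : ℕ) : qPoch z q (n + 1) = qPoch z q n * (1 - z * q ^ n) :=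
  Finset.prod_range_succ _ _

lemma qPoch_succ' (z q : ℂ) (n : ℕ) : qPoch z q (n + 1) = (1 - z) * qPoch (z * q) q n := by
  rw [qPoch, Finset.prod_range_succ', mul_comm, qPoch]
  simp [pow_succ', mul_assoc]

lemma tendsto_qPoch {q : ℂ} (hq : ‖q‖ < 1) (z : ℂ) :
    Tendsto (qPoch z q) atTop (𝓝 (qProd z q)) :=
  (multipliable_qProd hq z).hasProd.tendsto_prod_nat

lemma one_sub_mul_pow_ne_zero {q w : ℂ} (hq : ‖q‖ < 1) (hw : ‖w‖ < 1) (j : ℕ) :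
    1 - w * q ^ j ≠ 0 := by
  refine sub_ne_zero.2 fun h => ?_
  have := congrArg norm h
  rw [norm_mul, norm_pow, norm_one] at this
  have h1 : ‖q‖ ^ j ≤ 1 := pow_le_one₀ (norm_nonneg _) hq.le
  nlinarith [norm_nonneg w, pow_nonneg (norm_nonneg q) j]

lemma qPoch_ne_zero {q w : ℂ} (hq : ‖q‖ < 1) (hw : ‖w‖ < 1) (n : ℕ) : qPoch w q n ≠ 0 :=
  Finset.prod_ne_zero_iff.2 fun j _ => one_sub_mul_pow_ne_zero hq hw j

/-- The `N`-th term of the generating function of overpartitions by rank, which collects the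
overpartitions with largest part `N + 1`, up to the factor `2 q`. -/
noncomputable def rankTerm (q z : ℂ) (N : ℕ) : ℂ :=
  (z * q) ^ N * qPoch (-(q / z)) q N / qPoch (q / z) q (N + 1)

/-- The sum of `rankTerm q z`. -/
noncomputable def rankSum (q z : ℂ) : ℂ := ∑' N : ℕ, rankTerm q z N

lemma norm_div_lt_one {q z : ℂ} (hz : z ∈ annulus q) : ‖q / z‖ < 1 := by
  rw [norm_div]
  exact (div_lt_one (norm_pos_iff.2 (ne_zero_of_mem_annulus hz))).2 hz.1

lemma rankTerm_succ {q z : ℂ} (hq : ‖q‖ < 1) (hz : z ∈ annulus q) (N : ℕ) :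
    (1 - q / z * q ^ (N + 1)) * rankTerm q z (N + 1)
      = z * q * (1 + q / z * q ^ N) * rankTerm q z N := by
  have h1 := qPoch_ne_zero hq (norm_div_lt_one hz) (N + 1)
  have h2 := one_sub_mul_pow_ne_zero hq (norm_div_lt_one hz) (N + 1)
  rw [rankTerm, rankTerm, qPoch_succ (q / z) q (N + 1), qPoch_succ (-(q / z)) q N]
  generalize qPoch (q / z) q (N + 1) = u at *
  generalize 1 - q / z * q ^ (N + 1) = v at *
  field_simp
  ring

/-- A majorant of `rankTerm`. -/
noncomputable def rankBound (r t : ℝ) (N : ℕ) : ℝ :=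
  t ^ N * (∏ j ∈ Finset.range N, (1 + t * r ^ j)) / ∏ j ∈ Finset.range (N + 1), (1 - t * r ^ j)

/-- Ratio test: consecutive terms have ratio tending to `t < 1`. -/
lemma summable_rankBound {r t : ℝ} (hr0 : 0 ≤ r) (hr : r < 1) (ht0 : 0 < t) (ht : t < 1) :
    Summable (rankBound r t) := by
  have hden (j : ℕ) : 0 < 1 - t * r ^ j := by
    have : r ^ j ≤ 1 := pow_le_one₀ hr0 hr.le
    nlinarith [pow_nonneg hr0 j]
  have hpos (N : ℕ) : 0 < rankBound r t N :=
    div_pos (mul_pos (pow_pos ht0 N) (Finset.prod_pos fun j _ => by positivity))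
      (Finset.prod_pos fun j _ => hden j)
  have hratio (N : ℕ) : ‖rankBound r t (N + 1)‖ / ‖rankBound r t N‖
      = t * (1 + t * r ^ N) / (1 - t * r ^ (N + 1)) := by
    rw [Real.norm_of_nonneg (hpos _).le, Real.norm_of_nonneg (hpos _).le,
      div_eq_iff (hpos N).ne', rankBound, rankBound, Finset.prod_range_succ _ N,
      Finset.prod_range_succ _ (N + 1), pow_succ, div_mul_div_comm]
    congr 1 <;> ring
  refine summable_of_ratio_test_tendsto_lt_one ht (.of_forall fun N => (hpos N).ne') ?_
  simp only [hratio]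
  have h0 := tendsto_pow_atTop_nhds_zero_of_lt_one hr0 hr
  have h1 : Tendsto (fun N : ℕ => r ^ (N + 1)) atTop (𝓝 0) := (tendsto_add_atTop_iff_nat 1).2 h0
  have h2 := (((h0.const_mul t).const_add 1).const_mul t).div ((h1.const_mul t).const_sub 1)
    (by simp)
  simpa [Pi.div_def] using h2

lemma norm_rankTerm_le {q z : ℂ} {s : ℝ} (hq : ‖q‖ < 1) (hs0 : 0 < s)
    (hs : ‖q‖ < s) (hz1 : s < ‖z‖) (hz2 : ‖z‖ < s⁻¹) (N : ℕ) :
    ‖rankTerm q z N‖ ≤ rankBound ‖q‖ (‖q‖ / s) N := by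
  have ht : ‖q‖ / s < 1 := (div_lt_one hs0).2 hs
  have hw : ‖q / z‖ ≤ ‖q‖ / s := by
    rw [norm_div]; exact div_le_div_of_nonneg_left (norm_nonneg _) hs0 hz1.le
  have hterm (j : ℕ) : ‖q / z * q ^ j‖ ≤ ‖q‖ / s * ‖q‖ ^ j := by
    rw [norm_mul, norm_pow]; gcongr
  have hden (j : ℕ) : 0 < 1 - ‖q‖ / s * ‖q‖ ^ j := by
    have : ‖q‖ ^ j ≤ 1 := pow_le_one₀ (norm_nonneg _) hq.le
    have h0 : 0 ≤ ‖q‖ / s := by positivity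
    nlinarith [pow_nonneg (norm_nonneg q) j]
  rw [rankTerm, rankBound, norm_div, norm_mul, norm_pow, qPoch, qPoch, norm_prod, norm_prod]
  refine div_le_div₀ ?_ (mul_le_mul ?_ ?_ ?_ ?_) (Finset.prod_pos fun j _ => hden j) ?_
  · exact mul_nonneg (by positivity) (Finset.prod_nonneg fun j _ => by positivity)
  · refine pow_le_pow_left₀ (norm_nonneg _) ?_ N
    rw [norm_mul, div_eq_mul_inv, mul_comm]
    gcongr
  · refine Finset.prod_le_prod (fun j _ => norm_nonneg _) fun j _ => ?_
    calc ‖1 - -(q / z) * q ^ j‖ = ‖1 + q / z * q ^ j‖ := by ring_nf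
      _ ≤ ‖(1 : ℂ)‖ + ‖q / z * q ^ j‖ := norm_add_le _ _
      _ ≤ _ := by rw [norm_one]; gcongr; exact hterm j
  · exact Finset.prod_nonneg fun j _ => norm_nonneg _
  · positivity
  · refine Finset.prod_le_prod (fun j _ => (hden j).le) fun j _ => ?_
    have h3 := norm_sub_norm_le 1 (q / z * q ^ j)
    rw [norm_one] at h3
    linarith [hterm j]

lemma summable_norm_rankTerm {q z : ℂ} (hq0 : q ≠ 0) (hq : ‖q‖ < 1) (hz : z ∈ annulus q) :
    Summable fun N => ‖rankTerm q z N‖ := by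
  obtain ⟨s, h1, -, h3, h4⟩ := exists_between_annulus hq hz
  have hs0 : 0 < s := (norm_nonneg q).trans_lt h1
  exact Summable.of_nonneg_of_le (fun _ => norm_nonneg _) (norm_rankTerm_le hq hs0 h1 h3 h4)
    (summable_rankBound (norm_nonneg q) hq (div_pos (norm_pos_iff.2 hq0) hs0)
      ((div_lt_one hs0).2 h1))

lemma differentiableOn_rankSum {q : ℂ} (hq0 : q ≠ 0) (hq : ‖q‖ < 1) :
    DifferentiableOn ℂ (rankSum q) (annulus q) := by
  intro z hz
  obtain ⟨s, h1, -, h3, h4⟩ := exists_between_annulus hq hz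
  have hs0 : 0 < s := (norm_nonneg q).trans_lt h1
  let U : Set ℂ := {z | s < ‖z‖ ∧ ‖z‖ < s⁻¹}
  have hU : IsOpen U := (isOpen_lt continuous_const continuous_norm).inter
    (isOpen_lt continuous_norm continuous_const)
  have hsum : DifferentiableOn ℂ (fun z => ∑' N : ℕ, rankTerm q z N) U := by
    refine differentiableOn_tsum_of_summable_norm
      (summable_rankBound (norm_nonneg q) hq (div_pos (norm_pos_iff.2 hq0) hs0)
        ((div_lt_one hs0).2 h1)) (fun N w hw => ?_) hU fun N w hw =>
        norm_rankTerm_le hq hs0 h1 hw.1 hw.2 N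
    have hw0 : w ≠ 0 := norm_pos_iff.1 (hs0.trans hw.1)
    have hwq : ‖q / w‖ < 1 := by
      rw [norm_div]; exact (div_lt_one (hs0.trans hw.1)).2 (h1.trans hw.1)
    have hne := qPoch_ne_zero hq hwq (N + 1)
    unfold rankTerm
    refine DifferentiableAt.differentiableWithinAt (DifferentiableAt.div ?_ ?_ hne)
    · unfold qPoch
      fun_prop (disch := assumption)
    · unfold qPoch
      fun_prop (disch := assumption)
  exact (hsum.differentiableAt (hU.mem_nhds (⟨h3, h4⟩ : z ∈ U))).differentiableWithinAt

/-- Replacing `z` by `z q` turns `q / z` into `1 / z`; peeling off the first factor of each finite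
product restores `q / z`. -/
lemma rankTerm_mul_self_succ {q z : ℂ} (hq0 : q ≠ 0) (hz0 : z ≠ 0) (hz1 : z ≠ 1) (N : ℕ) :
    rankTerm q (z * q) (N + 1) = (z + 1) / (z - 1) * z * q ^ 2 * (q ^ N * rankTerm q z N) := by
  have h1 : z - 1 ≠ 0 := sub_ne_zero.2 hz1
  have h2 : (1 - z⁻¹) ≠ 0 := by
    rw [sub_ne_zero]; exact fun h => hz1 (by rw [← inv_inv z, ← h, inv_one])
  rw [rankTerm, rankTerm, show q / (z * q) = z⁻¹ by field_simp, qPoch_succ' (-z⁻¹),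
    qPoch_succ' z⁻¹, show -z⁻¹ * q = -(q / z) by field_simp, show z⁻¹ * q = q / z by field_simp]
  have h3 : (1 - -z⁻¹) / (1 - z⁻¹) = (z + 1) / (z - 1) := by
    rw [div_eq_div_iff h2 h1]; field_simp; ring
  rw [← h3]
  simp only [div_eq_mul_inv, mul_inv]
  ring

lemma rankSum_functional_equation {q z : ℂ} (hq0 : q ≠ 0) (hq : ‖q‖ < 1) (h1 : 1 < ‖z‖)
    (h2 : ‖z‖ < ‖q‖⁻¹) :
    (z - 1) * (1 + z * q) * rankSum q (z * q)
      = z * (1 - z ^ 2 * q + z * q * (1 + z) * (1 - z * q) * rankSum q z) := by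
  obtain ⟨hz, hzq, hz1, -⟩ := mul_mem_annulus hq0 hq h1 h2
  have hz0 := ne_zero_of_mem_annulus hz
  have hz1' : z - 1 ≠ 0 := sub_ne_zero.2 hz1
  have hA := (summable_norm_rankTerm hq0 hq hz).of_norm
  have hB : Summable fun N : ℕ => q ^ N * rankTerm q z N := by
    refine Summable.of_norm_bounded (summable_norm_rankTerm hq0 hq hz) fun N => ?_
    rw [norm_mul, norm_pow]
    exact mul_le_of_le_one_left (norm_nonneg _) (pow_le_one₀ (norm_nonneg _) hq.le)
  have h0 : rankTerm q z 0 * (1 - q / z) = 1 := by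
    have := one_sub_mul_pow_ne_zero hq (norm_div_lt_one hz) 0
    rw [pow_zero, mul_one] at this
    simp [rankTerm, qPoch, this]
  -- The auxiliary series `B` appears both in `rankSum q (z q)` (`e6`) and in the summed recurrence
  -- of the terms (`e7`); eliminating it leaves an equation for `rankSum` alone.
  set B := ∑' N : ℕ, q ^ N * rankTerm q z N with hBdef
  have e1 := hA.tsum_eq_zero_add
  have e2 := hB.tsum_eq_zero_add
  rw [← rankSum] at e1
  rw [← hBdef, pow_zero, one_mul] at e2
  have hA' := (summable_nat_add_iff 1).2 hA
  have hB' := (summable_nat_add_iff 1).2 hB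
  have e3 : ∑' N : ℕ, rankTerm q z (N + 1) - q / z * ∑' N : ℕ, q ^ (N + 1) * rankTerm q z (N + 1)
      = z * q * rankSum q z + q ^ 2 * B := by
    rw [rankSum, hBdef, ← tsum_mul_left, ← tsum_mul_left, ← tsum_mul_left,
      ← hA'.tsum_sub (hB'.mul_left _), ← (hA.mul_left _).tsum_add (hB.mul_left _)]
    refine tsum_congr fun N => ?_
    have := rankTerm_succ hq hz N
    have hzz : z * (q / z) = q := by field_simp
    linear_combination this + q ^ (N + 1) * rankTerm q z N * hzz
  have e4 := (summable_norm_rankTerm hq0 hq hzq).of_norm.tsum_eq_zero_add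
  simp only [rankTerm_mul_self_succ hq0 hz0 hz1] at e4
  rw [tsum_mul_left, ← rankSum, ← hBdef] at e4
  have e5 : rankTerm q (z * q) 0 * (z - 1) = z := by
    have hne : (1 - z⁻¹) ≠ 0 := by
      rw [sub_ne_zero]; exact fun h => hz1 (by rw [← inv_inv z, ← h, inv_one])
    rw [rankTerm, show q / (z * q) = z⁻¹ by field_simp]
    simp only [qPoch, pow_zero, Finset.range_zero, Finset.prod_empty, zero_add,
      Finset.range_one, Finset.prod_singleton, mul_one]
    rw [one_div, inv_mul_eq_iff_eq_mul₀ hne]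
    field_simp
  have e6 : (z - 1) * rankSum q (z * q) = z + (z + 1) * z * q ^ 2 * B := by
    rw [e4, mul_add, mul_comm, e5]
    field_simp
  have e7 : q * (1 + z * q) * B = z * ((1 - z * q) * rankSum q z - 1) := by
    have hzz : z * (q / z) = q := by field_simp
    linear_combination -z * e3 - z * h0 - z * e1 + q * e2 - (rankTerm q z 0
      + ∑' N : ℕ, q ^ (N + 1) * rankTerm q z (N + 1)) * hzz
  linear_combination (1 + z * q) * e6 + (z + 1) * z * q * e7

/-! ### The rank series as an Appell sum, and Gauss's identity -/

/-- The theta function `∑ₙ (-1)ⁿ q^{n²}`. -/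
noncomputable def thetaSum (q : ℂ) : ℂ := ∑' n : ℤ, (-1) ^ n * q ^ (n * n)

/-- The inhomogeneous parts of the two `q`-difference equations agree, so the difference `D` of the
two sides satisfies `(w - 1) D (w q) = w² (1 - w q) D w` (`e4`). Multiplication by the theta
product, which has no zero on the unit circle, reduces the multiplier to `w`, and such a function
vanishes. -/
lemma thetaSum_mul_rankSum_eq {q z : ℂ} (hq0 : q ≠ 0) (hq : ‖q‖ < 1) (hz : ‖z‖ = 1) :
    thetaSum q * (1 + q * (1 + z⁻¹) * rankSum q z) = appellReg q q z := by
  have h := eq_zero_of_quasiperiodic hq0 hq (F := fun z =>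
    (thetaSum q * (1 + q * (1 + z⁻¹) * rankSum q z) - appellReg q q z) * thetaProd q z) ?_ ?_ hz
  · exact sub_eq_zero.1 ((mul_eq_zero.1 h).resolve_right (thetaProd_ne_zero hq hz))
  · intro w hw
    have hw0 := ne_zero_of_mem_annulus hw
    have h1 := differentiableOn_rankSum hq0 hq w hw
    have h2 := differentiableOn_appellReg hq0 hq hq0 hq w hw
    have h3 := differentiableOn_thetaProd hq w hw
    have h4 : DifferentiableWithinAt ℂ (fun z : ℂ => q * (1 + z⁻¹)) (annulus q) w := by
      fun_prop (disch := assumption)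
    exact ((((h4.mul h1).const_add 1).const_mul _).sub h2).mul h3
  · intro w h1 h2
    obtain ⟨hw, hwq, hw1, hwq1⟩ := mul_mem_annulus hq0 hq h1 h2
    have hw0 := ne_zero_of_mem_annulus hw
    have hw1' : w - 1 ≠ 0 := sub_ne_zero.2 hw1
    have e1 := appell_functional_equation hq0 hq h1 h2
    have e2 := rankSum_functional_equation hq0 hq h1 h2
    have e3 := thetaProd_mul_self hq0 hq hw0
    rw [appellReg_eq hq0 hq hq0 hq hw hw1, appellReg_eq hq0 hq hq0 hq hwq hwq1]
    rw [← thetaSum] at e1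
    have e4 : (w - 1) * (thetaSum q * (1 + q * (1 + (w * q)⁻¹) * rankSum q (w * q))
        - (1 - w * q) * appell q q (w * q)) = w ^ 2 * (1 - w * q) * (thetaSum q *
        (1 + q * (1 + w⁻¹) * rankSum q w) - (1 - w) * appell q q w) := by
      have hq1 : q * (1 + (w * q)⁻¹) = (1 + w * q) * w⁻¹ := by field_simp; ring
      rw [hq1]
      have hww : w * w⁻¹ = 1 := mul_inv_cancel₀ hw0
      linear_combination (-(w - 1) * (1 - w * q)) * e1 + thetaSum q * w⁻¹ * e2
        + thetaSum q * ((1 - w ^ 2 * q + w * q * (1 + w) * (1 - w * q) * rankSum q w)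
          - w * (1 - w * q) * q * rankSum q w) * hww
    refine mul_left_cancel₀ hw1' ?_
    rw [← mul_assoc, e4]
    linear_combination (w * (thetaSum q * (1 + q * (1 + w⁻¹) * rankSum q w)
      - (1 - w) * appell q q w)) * e3

/-- At `z = 1` the series telescopes: both sides count overpartitions with parts at most `n`. -/
lemma one_add_sum_rankTerm_one {q : ℂ} (hq : ‖q‖ < 1) (n : ℕ) :
    1 + 2 * q * ∑ N ∈ Finset.range n, rankTerm q 1 N = qPoch (-q) q n / qPoch q q n := by
  induction n with
  | zero => simp [qPoch]
  | succ n ih =>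
    have h1 := qPoch_ne_zero hq hq n
    have h2 := one_sub_mul_pow_ne_zero hq hq n
    rw [Finset.sum_range_succ, mul_add, ← add_assoc, ih, rankTerm, div_one, qPoch_succ,
      qPoch_succ, one_mul]
    generalize qPoch q q n = u at *
    field_simp
    ring

lemma one_add_rankSum_one {q : ℂ} (hq0 : q ≠ 0) (hq : ‖q‖ < 1) :
    1 + 2 * q * rankSum q 1 = qProd (-q) q / qProd q q := by
  have h1 := (summable_norm_rankTerm hq0 hq
    (mem_annulus_of_norm_eq_one hq0 hq norm_one)).of_norm.hasSum.tendsto_sum_nat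
  have h2 := (h1.const_mul (2 * q)).const_add 1
  simp only [one_add_sum_rankTerm_one hq] at h2
  exact tendsto_nhds_unique h2
    ((tendsto_qPoch hq _).div (tendsto_qPoch hq _) (qProd_ne_zero_of_norm_lt hq hq))

/-- The identity of Gauss expressing the theta function as an infinite product. -/
lemma thetaSum_mul_qProd {q : ℂ} (hq0 : q ≠ 0) (hq : ‖q‖ < 1) :
    thetaSum q * (qProd (-q) q / qProd q q) = 1 := by
  have h := thetaSum_mul_rankSum_eq hq0 hq norm_one
  rw [appellReg_one, inv_one] at h
  rw [← one_add_rankSum_one hq0 hq]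
  linear_combination h

/-! ### Overpartitions counted by largest part -/

/-- An overpartition is a partition with a subset of its set of part sizes. -/
def overpartitionEquiv (n : ℕ) :
    Overpartition n ≃ Σ p : n.Partition, {S : Finset ℕ // S ∈ p.parts.toFinset.powerset} where
  toFun π := ⟨π.toPartition, ⟨π.overlined, Finset.mem_powerset.2 π.overlined_subset⟩⟩
  invFun x := ⟨x.1, x.2.1, Finset.mem_powerset.1 x.2.2⟩
  left_inv _ := rfl
  right_inv _ := rfl

lemma rankCoeff_eq_sum_partition (z : ℂ) (n : ℕ) :
    rankCoeff z n = ∑ p : n.Partition, (2 : ℂ) ^ p.parts.toFinset.card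
      * z ^ ((p.parts.sup : ℤ) - (Multiset.card p.parts : ℤ)) := by
  classical
  have := Fintype.ofFinite (Overpartition n)
  have hcount (m : ℤ) : rankCount m n
      = (Finset.univ.filter fun π : Overpartition n => π.rank = m).card := by
    rw [rankCount, Nat.card_eq_fintype_card, Fintype.card_subtype]
  have h1 : rankCoeff z n = ∑ π : Overpartition n, z ^ π.rank := by
    rw [rankCoeff, tsum_eq_sum (s := Finset.univ.image (Overpartition.rank (n := n))),
      Finset.sum_comp (fun m : ℤ => z ^ m) (Overpartition.rank (n := n))]
    · simp [hcount]
    · intro m hm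
      rw [hcount, Finset.filter_eq_empty_iff.2, Finset.card_empty, Nat.cast_zero, zero_mul]
      exact fun π _ h => hm (Finset.mem_image.2 ⟨π, Finset.mem_univ _, h⟩)
  rw [h1, ← (overpartitionEquiv n).symm.sum_comp, Fintype.sum_sigma]
  refine Finset.sum_congr rfl fun p _ => ?_
  simp [overpartitionEquiv, Overpartition.rank]

/-- The weighted number of overpartitions of `n` with largest part `M`, where each part has
weight `w`. -/
noncomputable def largestPartCoeff (w : ℂ) (M n : ℕ) : ℂ :=
  ∑ p : n.Partition, if p.parts.sup = M then
    (2 : ℂ) ^ p.parts.toFinset.card * w ^ Multiset.card p.parts else 0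

lemma rankCoeff_hasSum_largestPart {z : ℂ} (hz : z ≠ 0) (n : ℕ) :
    HasSum (fun M => z ^ M * largestPartCoeff z⁻¹ M n) (rankCoeff z n) := by
  rw [rankCoeff_eq_sum_partition]
  simp only [largestPartCoeff, Finset.mul_sum]
  refine hasSum_sum fun p _ => ?_
  convert hasSum_ite_eq p.parts.sup ((2 : ℂ) ^ p.parts.toFinset.card
      * z ^ ((p.parts.sup : ℤ) - (Multiset.card p.parts : ℤ))) using 2 with M
  by_cases h : p.parts.sup = M
  · rw [if_pos h, if_pos h.symm, zpow_sub₀ hz, zpow_natCast, zpow_natCast, h, inv_pow]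
    ring
  · rw [if_neg h, if_neg (Ne.symm h), mul_zero]

/-- The weighted generating function of the overpartitions with all parts at most `M`, as a power
series. -/
noncomputable def boundedPartSeries (w : ℂ) (M : ℕ) : PowerSeries ℂ :=
  Nat.Partition.genFun fun i c => if i ≤ M then 2 * w ^ c else 0

/-- Each distinct part size contributes a factor `2` (overlined or not), and the multiplicities add
up to the number of parts. -/
lemma coeff_boundedPartSeries (w : ℂ) (M n : ℕ) :
    (boundedPartSeries w M).coeff n = ∑ p : n.Partition, if p.parts.sup ≤ M then
      (2 : ℂ) ^ p.parts.toFinset.card * w ^ Multiset.card p.parts else 0 := by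
  rw [boundedPartSeries, Nat.Partition.coeff_genFun]
  refine Finset.sum_congr rfl fun p _ => ?_
  simp only [Finsupp.prod, Multiset.toFinsupp_support, Multiset.toFinsupp_apply]
  by_cases h : p.parts.sup ≤ M
  · rw [if_pos h, Finset.prod_congr rfl fun i hi => if_pos
      ((Multiset.le_sup (Multiset.mem_toFinset.1 hi)).trans h), Finset.prod_mul_distrib,
      Finset.prod_const, Finset.prod_pow_eq_pow_sum, Multiset.toFinset_sum_count_eq]
  · rw [if_neg h]
    simp only [Multiset.sup_le, not_forall] at h
    obtain ⟨i, hi, hM⟩ := h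
    exact Finset.prod_eq_zero (Multiset.mem_toFinset.2 hi) (if_neg hM)

lemma largestPartCoeff_zero (w : ℂ) (n : ℕ) :
    largestPartCoeff w 0 n = (boundedPartSeries w 0).coeff n := by
  simp only [coeff_boundedPartSeries, largestPartCoeff, Nat.le_zero]

lemma largestPartCoeff_succ (w : ℂ) (M n : ℕ) :
    largestPartCoeff w (M + 1) n
      = (boundedPartSeries w (M + 1)).coeff n - (boundedPartSeries w M).coeff n := by
  simp only [coeff_boundedPartSeries, largestPartCoeff, ← Finset.sum_sub_distrib]
  refine Finset.sum_congr rfl fun p _ => ?_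
  rcases lt_trichotomy p.parts.sup (M + 1) with h | h | h
  · rw [if_neg h.ne, if_pos h.le, if_pos (Nat.lt_succ_iff.1 h), sub_self]
  · rw [if_pos h, if_pos h.le, if_neg (by omega), sub_zero]
  · rw [if_neg h.ne', if_neg (by omega), if_neg (by omega), sub_zero]

/-- The generating function of the parts of size `k` of an overpartition. -/
noncomputable def partFactor (w : ℂ) (k : ℕ) : PowerSeries ℂ :=
  PowerSeries.mk fun m => if k ∣ m then 2 * w ^ (m / k) - (if m = 0 then 1 else 0) else 0

open scoped PowerSeries.WithPiTopology in
lemma one_add_tsum_eq_partFactor (w : ℂ) (i : ℕ) :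
    (1 + ∑' j : ℕ, (2 * w ^ (j + 1)) • (PowerSeries.X : PowerSeries ℂ) ^ ((i + 1) * (j + 1)))
      = partFactor w (i + 1) := by
  have hs := Nat.Partition.summable_genFun_term (fun _ c => 2 * w ^ c) i
  ext m
  rw [map_add, hs.map_tsum _ (PowerSeries.WithPiTopology.continuous_coeff ℂ m), partFactor,
    PowerSeries.coeff_mk]
  simp only [map_smul, PowerSeries.coeff_X_pow, smul_eq_mul, mul_ite, mul_one, mul_zero,
    PowerSeries.coeff_one]
  by_cases hd : i + 1 ∣ m
  · obtain ⟨j, rfl⟩ := hd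
    rw [if_pos (dvd_mul_right _ _), Nat.mul_div_cancel_left _ (Nat.succ_pos i)]
    rcases j with _ | j
    · simp
      norm_num
    · rw [if_neg (by simp), tsum_eq_single j fun l hl => if_neg fun h => hl ?_]
      · simp
      · have := Nat.eq_of_mul_eq_mul_left (Nat.succ_pos i) h
        omega
  · rw [if_neg hd, if_neg (by rintro rfl; simp at hd), zero_add]
    refine (tsum_congr fun l => if_neg ?_).trans tsum_zero
    rintro rfl
    exact hd (dvd_mul_right _ _)

open scoped PowerSeries.WithPiTopology in
lemma boundedPartSeries_eq_prod (w : ℂ) (M : ℕ) :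
    boundedPartSeries w M = ∏ i ∈ Finset.range M, partFactor w (i + 1) := by
  have h := Nat.Partition.hasProd_genFun fun i c => if i ≤ M then 2 * w ^ c else 0
  have hf (i : ℕ) : (1 + ∑' j : ℕ, (if i + 1 ≤ M then 2 * w ^ (j + 1) else 0)
      • (PowerSeries.X : PowerSeries ℂ) ^ ((i + 1) * (j + 1)))
      = if i ∈ Finset.range M then partFactor w (i + 1) else 1 := by
    by_cases hi : i < M
    · simp only [Nat.succ_le_of_lt hi, if_true, Finset.mem_range, hi, one_add_tsum_eq_partFactor]
    · simp [hi]
  simp only [hf] at h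
  have h2 := hasProd_prod_of_ne_finset_one (L := .unconditional ℕ) (s := Finset.range M)
    (f := fun i => if i ∈ Finset.range M then partFactor w (i + 1) else 1) (fun i hi => if_neg hi)
  rw [Finset.prod_congr rfl fun i hi => if_pos hi] at h2
  exact h.unique h2

/-- The power series `f` converges absolutely at `q`, with value `v`. -/
def HasEval (f : PowerSeries ℂ) (q v : ℂ) : Prop :=
  HasSum (fun n => f.coeff n * q ^ n) v

lemma HasEval.mul {f g : PowerSeries ℂ} {q v u : ℂ} (hf : HasEval f q v) (hg : HasEval g q u) :
    HasEval (f * g) q (v * u) := by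
  have h1 := summable_norm_sum_mul_antidiagonal_of_summable_norm hf.summable.norm hg.summable.norm
  have h2 := tsum_mul_tsum_eq_tsum_sum_antidiagonal_of_summable_norm
    hf.summable.norm hg.summable.norm
  rw [hf.tsum_eq, hg.tsum_eq] at h2
  rw [h2]
  unfold HasEval
  convert! h1.of_norm.hasSum using 2 with n
  rw [PowerSeries.coeff_mul, Finset.sum_mul]
  refine Finset.sum_congr rfl fun x hx => ?_
  rw [← Finset.HasAntidiagonal.mem_antidiagonal.1 hx, pow_add]
  ring

lemma hasEval_one (q : ℂ) : HasEval 1 q 1 := by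
  unfold HasEval
  convert hasSum_ite_eq (0 : ℕ) (1 : ℂ) using 2 with n
  by_cases h : n = 0 <;> simp [h, PowerSeries.coeff_one]

lemma hasEval_partFactor {w q : ℂ} {k : ℕ} (hk : 0 < k) (h : ‖w * q ^ k‖ < 1) :
    HasEval (partFactor w k) q ((1 + w * q ^ k) / (1 - w * q ^ k)) := by
  have hinj : Function.Injective fun j : ℕ => k * j := fun a b h =>
    Nat.eq_of_mul_eq_mul_left hk h
  rw [HasEval, ← hinj.hasSum_iff]
  -- Twice a geometric series minus `1`: an absent part size cannot be overlined, so it has weight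
  -- `1`, not `2`.
  · have h1 := ((hasSum_geometric_of_norm_lt_one h).mul_left 2).sub (hasSum_ite_eq (0 : ℕ) (1 : ℂ))
    have hne : 1 - w * q ^ k ≠ 0 := sub_ne_zero.2 fun h' => by rw [← h'] at h; simp at h
    convert! h1 using 1
    · ext j
      simp only [Function.comp_apply, partFactor, PowerSeries.coeff_mk, dvd_mul_right, if_true,
        Nat.mul_div_cancel_left _ hk, mul_pow, ← pow_mul, sub_mul]
      rcases j with _ | j
      · simp
      · simp [hk.ne']
        ring
    · field_simp
      ring
  · intro m hm
    rw [partFactor, PowerSeries.coeff_mk, if_neg, zero_mul]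
    rintro ⟨j, rfl⟩
    exact hm ⟨j, rfl⟩

lemma hasEval_boundedPartSeries {w q : ℂ} (hw : ‖w‖ = 1) (hq : ‖q‖ < 1) (M : ℕ) :
    HasEval (boundedPartSeries w M) q (qPoch (-(q * w)) q M / qPoch (q * w) q M) := by
  rw [boundedPartSeries_eq_prod]
  induction M with
  | zero => simpa [qPoch] using hasEval_one q
  | succ M ih =>
    rw [Finset.prod_range_succ, qPoch_succ, qPoch_succ, mul_div_mul_comm]
    have h : ‖w * q ^ (M + 1)‖ < 1 := by
      rw [norm_mul, hw, one_mul, norm_pow]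
      exact pow_lt_one₀ (norm_nonneg _) hq (Nat.succ_ne_zero M)
    convert! ih.mul (hasEval_partFactor M.add_one_pos h) using 3 <;> ring

lemma largestPartCoeff_zero_hasSum (w q : ℂ) :
    HasSum (fun n => largestPartCoeff w 0 n * q ^ n) 1 := by
  simp only [largestPartCoeff_zero]
  have := hasEval_one q
  rwa [← Finset.prod_range_zero fun i => partFactor w (i + 1), ← boundedPartSeries_eq_prod] at this

/-- With `x = q^{M+1} / z`, subtracting consecutive products leaves the factor `(1 + x) / (1 - x) -
1 = 2 x / (1 - x)`. -/
lemma largestPartCoeff_succ_hasSum {z q : ℂ} (hz : ‖z‖ = 1) (hq : ‖q‖ < 1) (M : ℕ) :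
    HasSum (fun n => z ^ (M + 1) * largestPartCoeff z⁻¹ (M + 1) n * q ^ n)
      (2 * q * rankTerm q z M) := by
  have hw : ‖z⁻¹‖ = 1 := by rw [norm_inv, hz, inv_one]
  have hz0 : z ≠ 0 := norm_ne_zero_iff.1 (by rw [hz]; exact one_ne_zero)
  have h := ((hasEval_boundedPartSeries hw hq (M + 1)).sub
    (hasEval_boundedPartSeries hw hq M)).mul_left (z ^ (M + 1))
  convert! h using 1
  · ext n
    rw [largestPartCoeff_succ]
    ring
  · have hwq : ‖q * z⁻¹‖ < 1 := by rwa [norm_mul, hw, mul_one]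
    have h1 := qPoch_ne_zero hq hwq M
    have h2 := one_sub_mul_pow_ne_zero hq hwq M
    rw [rankTerm, div_eq_mul_inv q z, qPoch_succ, qPoch_succ]
    generalize qPoch (q * z⁻¹) q M = u at *
    generalize qPoch (-(q * z⁻¹)) q M = v at *
    have h3 : 1 - -(q * z⁻¹) * q ^ M = 2 - (1 - q * z⁻¹ * q ^ M) := by ring
    have h4 : q ^ M * q = z * (1 - (1 - q * z⁻¹ * q ^ M)) := by field_simp; ring
    rw [h3, mul_pow, show 2 * q * (z ^ M * q ^ M * v / (u * (1 - q * z⁻¹ * q ^ M)))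
      = 2 * (z ^ M * (q ^ M * q) * v / (u * (1 - q * z⁻¹ * q ^ M))) by ring, h4]
    generalize 1 - q * z⁻¹ * q ^ M = t at *
    field_simp
    ring

/-- At `w = 1` the coefficients are nonnegative reals and dominate those for any `w` on the unit
circle. -/
lemma norm_largestPartCoeff_le {w : ℂ} (hw : ‖w‖ = 1) (M n : ℕ) :
    ‖largestPartCoeff w M n‖ ≤ ‖largestPartCoeff 1 M n‖ ∧
      ((‖largestPartCoeff 1 M n‖ : ℝ) : ℂ) = largestPartCoeff 1 M n := by
  have h1 : largestPartCoeff 1 M n = ((∑ p : n.Partition, if p.parts.sup = M then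
      (2 : ℝ) ^ p.parts.toFinset.card else 0 : ℝ) : ℂ) := by
    rw [largestPartCoeff]
    push_cast
    refine Finset.sum_congr rfl fun p _ => ?_
    split_ifs <;> simp
  have h0 : 0 ≤ (∑ p : n.Partition, if p.parts.sup = M then
      (2 : ℝ) ^ p.parts.toFinset.card else 0 : ℝ) :=
    Finset.sum_nonneg fun p _ => by split_ifs <;> positivity
  rw [h1, norm_real, Real.norm_of_nonneg h0]
  refine ⟨norm_sum_le_of_le _ fun p _ => ?_, rfl⟩
  split_ifs <;> simp [hw]

/-- Justifies summing over the largest part before the size. The majorant is the same double series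
at `z = 1` and `‖q‖`, whose terms are nonnegative and whose row sums are already known. -/
lemma summable_rank_double {z q : ℂ} (hz : ‖z‖ = 1) (hq0 : q ≠ 0) (hq : ‖q‖ < 1) :
    Summable fun x : ℕ × ℕ => z ^ x.1 * largestPartCoeff z⁻¹ x.1 x.2 * q ^ x.2 := by
  have hw : ‖z⁻¹‖ = 1 := by rw [norm_inv, hz, inv_one]
  have hr : ‖((‖q‖ : ℝ) : ℂ)‖ < 1 := by simpa using hq
  have hr0 : ((‖q‖ : ℝ) : ℂ) ≠ 0 := by simpa using hq0
  have hM (M : ℕ) : Summable fun n => ‖largestPartCoeff 1 (M + 1) n‖ * ‖q‖ ^ n := by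
    simpa using (largestPartCoeff_succ_hasSum norm_one hr M).summable.norm
  have hsum : Summable fun x : ℕ × ℕ => ‖largestPartCoeff 1 x.1 x.2‖ * ‖q‖ ^ x.2 := by
    refine (summable_prod_of_nonneg fun x => by positivity).2 ⟨fun M => ?_, ?_⟩
    · rcases M with _ | M
      · simpa using (largestPartCoeff_zero_hasSum 1 (‖q‖ : ℂ)).summable.norm
      · exact hM M
    · rw [← summable_nat_add_iff 1]
      refine ((summable_norm_rankTerm hr0 hr
        (mem_annulus_of_norm_eq_one hr0 hr norm_one)).mul_left ‖2 * ((‖q‖ : ℝ) : ℂ)‖).congr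
        fun M => ?_
      have h := (largestPartCoeff_succ_hasSum norm_one hr M).tsum_eq
      rw [← norm_mul, ← h, ← Real.norm_of_nonneg (tsum_nonneg fun n => by positivity), ← norm_real,
        ofReal_tsum]
      congr 1
      refine tsum_congr fun n => ?_
      rw [ofReal_mul, (norm_largestPartCoeff_le norm_one (M + 1) n).2]
      simp
  refine hsum.of_norm_bounded fun x => ?_
  rw [norm_mul, norm_mul, norm_pow, norm_pow, hz, one_pow, one_mul]
  gcongr
  exact (norm_largestPartCoeff_le hw _ _).1

/-- The generating function of overpartitions by rank, summed over the largest part. -/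
lemma rankFunction_hasSum {z q : ℂ} (hz : ‖z‖ = 1) (hq0 : q ≠ 0) (hq : ‖q‖ < 1) :
    HasSum (fun n => rankCoeff z n * q ^ n) (1 + 2 * q * rankSum q z) := by
  have hz0 : z ≠ 0 := norm_ne_zero_iff.1 (by rw [hz]; exact one_ne_zero)
  have hS := summable_rank_double hz hq0 hq
  have h1 := hS.prod_symm.hasSum.prod_fiberwise fun n =>
    (rankCoeff_hasSum_largestPart hz0 n).mul_right (q ^ n)
  convert h1 using 1
  rw [← (Equiv.prodComm ℕ ℕ).tsum_eq]
  simp only [Equiv.prodComm_apply, Prod.swap_swap]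
  rw [hS.tsum_prod]
  have hR : HasSum (fun M => ∑' n, z ^ M * largestPartCoeff z⁻¹ M n * q ^ n)
      (1 + 2 * q * rankSum q z) := by
    rw [← hasSum_nat_add_iff' 1]
    simp only [Finset.range_one, Finset.sum_singleton, pow_zero, one_mul,
      (largestPartCoeff_zero_hasSum z⁻¹ q).tsum_eq, (largestPartCoeff_succ_hasSum hz hq _).tsum_eq,
      add_sub_cancel_left]
    exact (summable_norm_rankTerm hq0 hq
      (mem_annulus_of_norm_eq_one hq0 hq hz)).of_norm.hasSum.mul_left _
  exact hR.tsum_eq.symm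

/-! ### The error function and the period integral -/

lemma continuous_gaussian : Continuous fun w : ℝ => Real.exp (-Real.pi * w ^ 2) := by fun_prop

lemma hasDerivAt_errorE (x : ℝ) : HasDerivAt errorE (2 * Real.exp (-Real.pi * x ^ 2)) x :=
  (intervalIntegral.integral_hasDerivAt_right (continuous_gaussian.intervalIntegrable _ _)
    continuous_gaussian.aestronglyMeasurable.stronglyMeasurableAtFilter
    continuous_gaussian.continuousAt).const_mul 2

lemma errorE_neg (x : ℝ) : errorE (-x) = -errorE x := by
  have h := intervalIntegral.integral_comp_neg (a := 0) (b := x)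
    (fun w : ℝ => Real.exp (-Real.pi * w ^ 2))
  simp only [neg_sq, neg_zero] at h
  rw [errorE, errorE, intervalIntegral.integral_symm, ← h, mul_neg]

lemma errorE_zero : errorE 0 = 0 := by simp [errorE]

lemma tendsto_errorE : Tendsto errorE atTop (𝓝 1) := by
  have h := (intervalIntegral_tendsto_integral_Ioi 0
    ((integrable_exp_neg_mul_sq Real.pi_pos).integrableOn) tendsto_id).const_mul 2
  rw [integral_gaussian_Ioi, div_self Real.pi_ne_zero, Real.sqrt_one] at h
  change Tendsto (fun x : ℝ => 2 * ∫ w in (0 : ℝ)..x, Real.exp (-Real.pi * w ^ 2)) atTop (𝓝 1)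
  simpa using h

lemma sign_add_half {k : ℤ} (hk : 0 < k) : Real.sign ((k : ℝ) + 1 / 2) = 1 := by
  have : (0 : ℝ) < k := by exact_mod_cast hk
  exact Real.sign_of_pos (by linarith)

lemma sign_add_half_of_neg {k : ℤ} (hk : k < 0) : Real.sign ((k : ℝ) + 1 / 2) = -1 := by
  have : (k : ℝ) ≤ -1 := by exact_mod_cast (by omega : k ≤ -1)
  exact Real.sign_of_neg (by linarith)

lemma tendsto_errorE_int_mul {k : ℤ} (hk : k ≠ 0) :
    Tendsto (fun s : ℝ => errorE (k * s)) atTop (𝓝 (Real.sign ((k : ℝ) + 1 / 2))) := by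
  rcases lt_or_gt_of_ne hk with h | h
  · rw [sign_add_half_of_neg h]
    have h1 : (0 : ℝ) < -k := by exact_mod_cast neg_pos.2 h
    have h2 := (tendsto_errorE.comp (tendsto_id.const_mul_atTop h1)).neg
    refine h2.congr fun s => ?_
    simp only [Function.comp_apply, id_eq]
    rw [← errorE_neg]
    ring_nf
  · rw [sign_add_half h]
    exact tendsto_errorE.comp (tendsto_id.const_mul_atTop (by exact_mod_cast h))

lemma integrableOn_exp_div_sqrt {y : ℝ} (hy : 0 < y) {r : ℝ} (hr : 0 < r) :
    IntegrableOn (fun t : ℝ => Real.exp (-r * t) / Real.sqrt (2 * y + t)) (Set.Ioi 0) := by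
  refine Integrable.mono' ((integrableOn_exp_mul_Ioi (neg_lt_zero.2 hr) 0).div_const
    (Real.sqrt (2 * y))) ?_ ?_
  · refine (Measurable.div (by fun_prop) (by fun_prop)).aestronglyMeasurable
  · filter_upwards [self_mem_ae_restrict measurableSet_Ioi] with t ht
    rw [Real.norm_of_nonneg (by positivity)]
    have : 0 < Real.sqrt (2 * y) := by positivity
    gcongr
    linarith [Set.mem_Ioi.1 ht]

/-- `t ↦ E(k √(2 (2 y + t)))` runs from `E(k √(4 y))` at `t = 0` to `sgn k` at infinity; the
integrand is its derivative. For `k ≠ 0` the sign of `k + 1/2` is that of `k`. -/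
lemma sign_sub_errorE_eq_integral {y : ℝ} (hy : 0 < y) {k : ℤ} (hk : k ≠ 0) :
    Real.sign ((k : ℝ) + 1 / 2) - errorE (k * Real.sqrt (2 * (2 * y)))
      = Real.sqrt 2 * k * Real.exp (-4 * Real.pi * k ^ 2 * y)
        * ∫ t in Set.Ioi (0 : ℝ), Real.exp (-(2 * Real.pi * k ^ 2) * t)
          / Real.sqrt (2 * y + t) := by
  have hk' : (0 : ℝ) < k ^ 2 := by
    have : (k : ℝ) ≠ 0 := by exact_mod_cast hk
    positivity
  rw [← integral_const_mul]
  have h := integral_Ioi_of_hasDerivAt_of_tendsto' (a := 0) (m := Real.sign ((k : ℝ) + 1 / 2))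
    (f := fun t : ℝ => errorE (k * Real.sqrt (2 * (2 * y + t))))
    (f' := fun t : ℝ => Real.sqrt 2 * k * Real.exp (-4 * Real.pi * k ^ 2 * y)
        * (Real.exp (-(2 * Real.pi * k ^ 2) * t) / Real.sqrt (2 * y + t))) ?_ ?_ ?_
  · rw [h, add_zero]
  · intro t ht
    have ht0 : 0 < 2 * y + t := by linarith [Set.mem_Ici.1 ht]
    have h1 : HasDerivAt (fun t : ℝ => 2 * (2 * y + t)) 2 t := by
      simpa using ((hasDerivAt_id t).const_add (2 * y)).const_mul 2
    have h2 := (hasDerivAt_errorE _).comp t ((h1.sqrt (by positivity)).const_mul (k : ℝ))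
    convert! h2 using 1
    rw [mul_pow, Real.sq_sqrt (by positivity), Real.sqrt_mul zero_le_two,
      show -Real.pi * (k ^ 2 * (2 * (2 * y + t)))
        = -4 * Real.pi * k ^ 2 * y + -(2 * Real.pi * k ^ 2) * t by ring, Real.exp_add]
    have h3 : Real.sqrt 2 * Real.sqrt 2 = 2 := Real.mul_self_sqrt zero_le_two
    have h4 : Real.sqrt (2 * y + t) ≠ 0 := by positivity
    have h5 : Real.sqrt 2 ≠ 0 := by positivity
    generalize Real.sqrt (2 * y + t) = s at *
    generalize Real.sqrt 2 = v at *
    field_simp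
    linear_combination h3
  · exact (integrableOn_exp_div_sqrt hy (by positivity)).const_mul _
  · refine (tendsto_errorE_int_mul hk).comp (Real.tendsto_sqrt_atTop.comp ?_)
    exact (tendsto_atTop_add_const_left _ _ tendsto_id).const_mul_atTop two_pos

/-- The `k`-th term of the integrand `g_{0,b}(2z) / √(-i (z + τ))` at `z = -τ̄ + i t`. -/
noncomputable def periodTerm (b : ℝ) (τ : ℂ) (k : ℤ) (t : ℝ) : ℂ :=
  k * cexp (2 * Real.pi * I * k * b) * cexp (-2 * Real.pi * I * k ^ 2 * (starRingEnd ℂ) τ)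
    * ((Real.exp (-(2 * Real.pi * k ^ 2) * t) / Real.sqrt (2 * τ.im + t) : ℝ) : ℂ)

/-- On the ray `z = -τ̄ + i t` one has `-i (z + τ) = 2 Im τ + t > 0`, so the principal root is a
real square root. -/
lemma unaryTheta_div_sqrt_eq_tsum (b : ℝ) {τ : ℂ} (hτ : 0 < τ.im) {t : ℝ} (ht : 0 < t) :
    unaryTheta 0 b (2 * (-(starRingEnd ℂ) τ + I * t))
      / Complex.sqrt (-I * (-(starRingEnd ℂ) τ + I * t + τ)) = ∑' k : ℤ, periodTerm b τ k t := by
  have h1 : -I * (-(starRingEnd ℂ) τ + I * t + τ) = ((2 * τ.im + t : ℝ) : ℂ) := by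
    apply Complex.ext <;> simp
    ring
  have h2 : Complex.sqrt ((2 * τ.im + t : ℝ) : ℂ) = (Real.sqrt (2 * τ.im + t) : ℂ) := by
    rw [Complex.sqrt_of_nonneg (by exact_mod_cast (by positivity : 0 ≤ 2 * τ.im + t)), ofReal_re]
  rw [h1, h2, unaryTheta, ← tsum_div_const]
  refine tsum_congr fun k => ?_
  rw [periodTerm, ofReal_div, ofReal_exp, ofReal_zero, add_zero]
  rw [show (Real.pi * I * (k : ℂ) ^ 2 * (2 * (-(starRingEnd ℂ) τ + I * t))
      + 2 * Real.pi * I * k * b) = 2 * Real.pi * I * k * b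
        + -2 * Real.pi * I * k ^ 2 * (starRingEnd ℂ) τ + ((-(2 * Real.pi * k ^ 2) * t : ℝ) : ℂ) by
      push_cast
      linear_combination (2 * Real.pi * k ^ 2 * t : ℂ) * I_mul_I,
    Complex.exp_add, Complex.exp_add]
  ring

/-- A bound that separates `k` from `t`, which gives integrability and termwise integration
together. The term `k = 0` vanishes, so `exp (-2π k² t) ≤ exp (-2π t)` may be used. -/
lemma norm_periodTerm_le (b : ℝ) {τ : ℂ} (hτ : 0 < τ.im) (k : ℤ) {t : ℝ} (ht : 0 < t) :
    ‖periodTerm b τ k t‖ ≤ (|k| ^ 1 : ℝ) * Real.exp (-(2 * Real.pi * τ.im)) ^ (k * k + 0 * k)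
      * (Real.exp (-(2 * Real.pi) * t) / Real.sqrt (2 * τ.im)) := by
  by_cases hk : k = 0
  · simp [periodTerm, hk]
  have hk1 : (1 : ℝ) ≤ k ^ 2 := by
    have h : 0 < k ^ 2 := by positivity
    exact_mod_cast Int.add_one_le_iff.2 h
  have h1 : ‖cexp (2 * Real.pi * I * k * b)‖ = 1 := by
    rw [show (2 * Real.pi * I * k * b : ℂ) = ((2 * Real.pi * k * b : ℝ) : ℂ) * I by
      push_cast; ring, norm_exp_ofReal_mul_I]
  have h2 : ‖cexp (-2 * Real.pi * I * k ^ 2 * (starRingEnd ℂ) τ)‖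
      = Real.exp (-(2 * Real.pi * τ.im)) ^ (k * k + 0 * k) := by
    rw [norm_exp, ← Real.rpow_intCast, ← Real.exp_mul,
      show (-2 * Real.pi * I * k ^ 2 * (starRingEnd ℂ) τ : ℂ)
      = ((-2 * Real.pi * k ^ 2 : ℝ) : ℂ) * (I * (starRingEnd ℂ) τ) by push_cast; ring,
      re_ofReal_mul]
    congr 1
    simp
    ring
  have h3 : ‖((k : ℤ) : ℂ)‖ = (|k| ^ 1 : ℝ) := by
    rw [pow_one, norm_intCast, Int.cast_abs]
  rw [periodTerm, norm_mul, norm_mul, norm_mul, h1, h2, h3, mul_one, norm_real,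
    Real.norm_of_nonneg (by positivity)]
  have h4 : 0 < Real.sqrt (2 * τ.im) := by positivity
  refine mul_le_mul_of_nonneg_left (div_le_div₀ (Real.exp_pos _).le (Real.exp_le_exp.2 ?_) h4
    (Real.sqrt_le_sqrt (by linarith))) (by positivity)
  nlinarith [mul_le_mul_of_nonneg_right hk1 (by positivity : 0 ≤ 2 * Real.pi * t)]

lemma summable_periodBound {τ : ℂ} (hτ : 0 < τ.im) :
    Summable fun k : ℤ =>
      (|k| ^ 1 : ℝ) * Real.exp (-(2 * Real.pi * τ.im)) ^ (k * k + 0 * k) :=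
  summable_abs_pow_mul_zpow (Real.exp_pos _) (by rw [Real.exp_lt_one_iff]; simp; positivity) 1 0

lemma continuousOn_periodTerm (b : ℝ) {τ : ℂ} (hτ : 0 < τ.im) (k : ℤ) :
    ContinuousOn (periodTerm b τ k) (Set.Ioi 0) := by
  unfold periodTerm
  refine continuousOn_const.mul (continuous_ofReal.comp_continuousOn ?_)
  refine ContinuousOn.div (by fun_prop) (by fun_prop) fun t ht => ?_
  have : 0 < 2 * τ.im + t := by linarith [Set.mem_Ioi.1 ht]
  positivity

lemma integrableOn_periodBound (τ : ℂ) :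
    IntegrableOn (fun t : ℝ => Real.exp (-(2 * Real.pi) * t) / Real.sqrt (2 * τ.im))
      (Set.Ioi 0) :=
  (integrableOn_exp_mul_Ioi (neg_lt_zero.2 Real.two_pi_pos) 0).div_const _

lemma integrableOn_periodTerm (b : ℝ) {τ : ℂ} (hτ : 0 < τ.im) (k : ℤ) :
    IntegrableOn (periodTerm b τ k) (Set.Ioi 0) := by
  refine Integrable.mono' ((integrableOn_periodBound τ).const_mul
    ((|k| ^ 1 : ℝ) * Real.exp (-(2 * Real.pi * τ.im)) ^ (k * k + 0 * k)))
    ((continuousOn_periodTerm b hτ k).aestronglyMeasurable measurableSet_Ioi) ?_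
  filter_upwards [self_mem_ae_restrict measurableSet_Ioi] with t ht
  exact norm_periodTerm_le b hτ k ht

lemma integrableOn_tsum_periodTerm (b : ℝ) {τ : ℂ} (hτ : 0 < τ.im) :
    IntegrableOn (fun t => ∑' k : ℤ, periodTerm b τ k t) (Set.Ioi 0) := by
  refine Integrable.mono' ((integrableOn_periodBound τ).const_mul (∑' k : ℤ,
    (|k| ^ 1 : ℝ) * Real.exp (-(2 * Real.pi * τ.im)) ^ (k * k + 0 * k))) ?_ ?_
  · refine ContinuousOn.aestronglyMeasurable ?_ measurableSet_Ioi
    refine continuousOn_tsum (continuousOn_periodTerm b hτ)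
      ((summable_periodBound hτ).mul_right (1 / Real.sqrt (2 * τ.im))) fun k t ht => ?_
    refine (norm_periodTerm_le b hτ k ht).trans ?_
    gcongr
    rw [Real.exp_le_one_iff]
    nlinarith [Real.pi_pos, Set.mem_Ioi.1 ht]
  · filter_upwards [self_mem_ae_restrict measurableSet_Ioi] with t ht
    rw [← tsum_mul_right]
    exact tsum_of_norm_bounded ((summable_periodBound hτ).mul_right _).hasSum
      fun k => norm_periodTerm_le b hτ k ht

lemma hasSum_integral_periodTerm (b : ℝ) {τ : ℂ} (hτ : 0 < τ.im) :
    HasSum (fun k : ℤ => ∫ t in Set.Ioi (0 : ℝ), periodTerm b τ k t)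
      (∫ t in Set.Ioi (0 : ℝ), ∑' k : ℤ, periodTerm b τ k t) := by
  refine hasSum_integral_of_summable_integral_norm (integrableOn_periodTerm b hτ) ?_
  refine Summable.of_nonneg_of_le (fun k => integral_nonneg fun t => norm_nonneg _) (fun k => ?_)
    ((summable_periodBound hτ).mul_right
      (∫ t in Set.Ioi (0 : ℝ), Real.exp (-(2 * Real.pi) * t) / Real.sqrt (2 * τ.im)))
  rw [← integral_const_mul]
  refine integral_mono_ae (integrableOn_periodTerm b hτ k).norm
    ((integrableOn_periodBound τ).const_mul _) ?_
  filter_upwards [self_mem_ae_restrict measurableSet_Ioi] with t ht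
  exact norm_periodTerm_le b hτ k ht

lemma sqrt_two_mul_integral_periodTerm (b : ℝ) {τ : ℂ} (hτ : 0 < τ.im) (k : ℤ) :
    (Real.sqrt 2 : ℂ) * ∫ t in Set.Ioi (0 : ℝ), periodTerm b τ k t
      = if k = 0 then 0 else
        ((Real.sign ((k : ℝ) + 1 / 2) - errorE (k * Real.sqrt (2 * (2 * τ.im))) : ℝ) : ℂ)
          * cexp (2 * Real.pi * I * k * b) * cexp (-2 * Real.pi * I * k ^ 2 * τ) := by
  by_cases hk : k = 0
  · simp [hk, periodTerm]
  rw [if_neg hk, sign_sub_errorE_eq_integral hτ hk]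
  simp only [periodTerm]
  rw [integral_const_mul, integral_complex_ofReal]
  -- Replacing `τ̄` by `τ` costs exactly the real factor that occurs in
  -- `sign_sub_errorE_eq_integral`.
  have hconj : cexp (-2 * Real.pi * I * k ^ 2 * (starRingEnd ℂ) τ)
      = cexp ((-4 * Real.pi * k ^ 2 * τ.im : ℝ) : ℂ) * cexp (-2 * Real.pi * I * k ^ 2 * τ) := by
    rw [← Complex.exp_add]
    congr 1
    have h : (starRingEnd ℂ) τ = τ - 2 * τ.im * I := by
      apply Complex.ext <;> simp
      ring
    rw [h]
    push_cast
    linear_combination (4 * Real.pi * k ^ 2 * τ.im : ℂ) * I_mul_I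
  rw [hconj]
  push_cast
  ring

lemma hasSum_sign_sub_errorE (b : ℝ) {τ : ℂ} (hτ : 0 < τ.im) :
    HasSum (fun k : ℤ => if k = 0 then 0 else
        ((Real.sign ((k : ℝ) + 1 / 2) - errorE (k * Real.sqrt (2 * (2 * τ.im))) : ℝ) : ℂ)
          * cexp (2 * Real.pi * I * k * b) * cexp (-2 * Real.pi * I * k ^ 2 * τ))
      ((Real.sqrt 2 : ℂ) * ∫ t in Set.Ioi (0 : ℝ), ∑' k : ℤ, periodTerm b τ k t) := by
  simp only [← sqrt_two_mul_integral_periodTerm b hτ]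
  exact (hasSum_integral_periodTerm b hτ).mul_left _

lemma integrableToIInfty_periodIntegrand (a c : ℤ) {τ : ℂ} (hτ : 0 < τ.im) :
    IntegrableToIInfty (periodIntegrand a c τ) (-(starRingEnd ℂ) τ) := by
  refine (integrableOn_tsum_periodTerm (1 / 2 - 2 * a / c) hτ).congr_fun (fun t ht => ?_)
    measurableSet_Ioi
  exact (unaryTheta_div_sqrt_eq_tsum _ hτ ht).symm

lemma integralToIInfty_periodIntegrand (a c : ℤ) {τ : ℂ} (hτ : 0 < τ.im) :
    integralToIInfty (periodIntegrand a c τ) (-(starRingEnd ℂ) τ)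
      = I * ∫ t in Set.Ioi (0 : ℝ), ∑' k : ℤ, periodTerm (1 / 2 - 2 * a / c) τ k t := by
  rw [integralToIInfty]
  congr 1
  exact setIntegral_congr_fun measurableSet_Ioi fun t ht =>
    unaryTheta_div_sqrt_eq_tsum (1 / 2 - 2 * a / c) hτ ht

/-! ### Specialisation to roots of unity and assembly -/

lemma nome_ne_zero (τ : ℂ) : nome τ ≠ 0 := Complex.exp_ne_zero _

lemma norm_nome_lt_one {τ : ℂ} (hτ : 0 < τ.im) : ‖nome τ‖ < 1 := by
  rw [nome, norm_exp, Real.exp_lt_one_iff]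
  simp
  positivity

lemma nome_zpow (τ : ℂ) (n : ℤ) : nome τ ^ n = cexp (2 * Real.pi * I * n * τ) := by
  rw [nome, ← Complex.exp_int_mul]
  ring_nf

lemma neg_one_zpow_eq_exp (n : ℤ) : (-1 : ℂ) ^ n = cexp (Real.pi * I * n) := by
  rw [← exp_pi_mul_I, ← Complex.exp_int_mul, mul_comm]

lemma zeta_zpow (a c : ℤ) : zeta c ^ a = cexp (Real.pi * I * (2 * a / c)) := by
  rw [zeta, ← Complex.exp_int_mul]
  ring_nf

lemma norm_zeta_zpow (a c : ℤ) : ‖zeta c ^ a‖ = 1 := by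
  rw [zeta_zpow, show (Real.pi * I * (2 * a / c) : ℂ) = ((Real.pi * (2 * a / c) : ℝ) : ℂ) * I by
    push_cast; ring, norm_exp_ofReal_mul_I]

lemma zeta_zpow_sq (a c : ℤ) : (zeta c ^ a) ^ 2 = cexp (2 * Real.pi * I * (2 * a / c)) := by
  rw [zeta_zpow, ← Complex.exp_nat_mul]
  push_cast
  ring_nf

/-- The only use of `c ∤ 2 a`: it keeps `1 - z`, `1 + z` and the theta product in `P` away from
zero. -/
lemma zeta_zpow_sq_ne_one {a c : ℤ} (hc : 0 < c) (hac : ¬ c ∣ 2 * a) : (zeta c ^ a) ^ 2 ≠ 1 := by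
  rw [zeta_zpow_sq, Ne, Complex.exp_eq_one_iff]
  rintro ⟨n, hn⟩
  have hc' : (c : ℂ) ≠ 0 := by exact_mod_cast hc.ne'
  rw [mul_comm (n : ℂ), mul_right_inj' two_pi_I_ne_zero, div_eq_iff hc'] at hn
  exact hac ⟨n, by rw [mul_comm c]; exact_mod_cast hn⟩

lemma vartheta_eq_thetaSum (τ : ℂ) :
    vartheta τ (2 * τ) = -I * cexp (2 * Real.pi * I * τ * (-1 / 4)) * thetaSum (nome τ) := by
  rw [vartheta, thetaSum, ← tsum_mul_left, ← (Equiv.addRight (1 : ℤ)).tsum_eq (fun n : ℤ =>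
    -I * cexp (2 * Real.pi * I * τ * (-1 / 4)) * ((-1) ^ n * nome τ ^ (n * n)))]
  refine tsum_congr fun k => ?_
  simp only [Equiv.coe_addRight]
  rw [nome_zpow, zpow_add₀ (neg_ne_zero.2 one_ne_zero), zpow_one, neg_one_zpow_eq_exp]
  have hI : I = cexp (Real.pi / 2 * I) := exp_pi_div_two_mul_I.symm
  have h : -I * cexp (2 * Real.pi * I * τ * (-1 / 4)) * (cexp (Real.pi * I * k) * -1 *
      cexp (2 * Real.pi * I * ((k + 1) * (k + 1) : ℤ) * τ)) = cexp (Real.pi / 2 * I) *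
      cexp (2 * Real.pi * I * τ * (-1 / 4)) * cexp (Real.pi * I * k) *
      cexp (2 * Real.pi * I * ((k + 1) * (k + 1) : ℤ) * τ) := by
    rw [← hI]; ring
  rw [h, ← Complex.exp_add, ← Complex.exp_add, ← Complex.exp_add]
  congr 1
  push_cast
  ring

/-- The Appell sum with numerators `(-1)ⁿ q^{n² + 2n}`. -/
noncomputable def shiftedAppell (q p z : ℂ) : ℂ :=
  ∑' n : ℤ, (-1) ^ n * q ^ (n * n + 2 * n) / (1 - z * p ^ n)

lemma mu_eq (a c : ℤ) (τ : ℂ) :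
    mu (2 * a / c) τ (2 * τ) = zeta c ^ a / vartheta τ (2 * τ)
      * shiftedAppell (nome τ) (nome τ ^ 2) ((zeta c ^ a) ^ 2) := by
  rw [mu, shiftedAppell, ← zeta_zpow]
  congr 1
  refine tsum_congr fun n => ?_
  rw [nome_zpow, zeta_zpow_sq, ← zpow_natCast (nome τ) 2, ← zpow_mul, nome_zpow,
    ← Complex.exp_add]
  push_cast
  ring_nf

/-- Termwise, `1 / (1 - z x) = (1 + z x) / (1 - z² x²)` with `x = qⁿ`. -/
lemma appell_eq_add {q z : ℂ} (hq0 : q ≠ 0) (hq : ‖q‖ < 1) (hz : ‖z‖ = 1) (hz2 : z ^ 2 ≠ 1) :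
    appell q q z = appell q (q ^ 2) (z ^ 2) + z * shiftedAppell q (q ^ 2) (z ^ 2) := by
  have hp0 : q ^ 2 ≠ 0 := pow_ne_zero 2 hq0
  have hp : ‖q ^ 2‖ < 1 := by rw [norm_pow]; exact pow_lt_one₀ (norm_nonneg _) hq two_ne_zero
  have hzn : ‖z ^ 2‖ = 1 := by rw [norm_pow, hz, one_pow]
  have hm := mem_annulus_of_norm_eq_one hp0 hp hzn
  have hs1 := summable_div_one_sub hp0 hp hm (summable_appell_coeff hq0 hq)
  have hs2 := summable_div_one_sub hp0 hp hm (summable_neg_one_zpow_mul_zpow hq0 hq 2)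
  rw [appell, appell, shiftedAppell, ← tsum_mul_left, ← hs1.tsum_add (hs2.mul_left z)]
  refine tsum_congr fun n => ?_
  have h2 := one_sub_mul_zpow_ne_zero' hp0 hp hm hz2 n
  have hpow : (q ^ 2) ^ n = (q ^ n) ^ 2 := by
    rw [← zpow_natCast, ← zpow_natCast, ← zpow_mul, ← zpow_mul, mul_comm]
  rw [hpow] at h2 ⊢
  have hfac : 1 - z ^ 2 * (q ^ n) ^ 2 = (1 - z * q ^ n) * (1 + z * q ^ n) := by ring
  rw [hfac] at h2 ⊢
  have h3 := left_ne_zero_of_mul h2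
  have h4 := right_ne_zero_of_mul h2
  rw [show n * n + 2 * n = n * n + n + n by ring, zpow_add₀ hq0 (n * n + n)]
  field_simp

lemma zwegersR_eq (a c : ℤ) {τ : ℂ} (hτ : 0 < τ.im) :
    cexp (2 * Real.pi * I * τ * (-1 / 4)) * zwegersR (2 * a / c - τ) (2 * τ)
      = (zeta c ^ a)⁻¹ * (1 + (Real.sqrt 2 : ℂ) * ∫ t in Set.Ioi (0 : ℝ),
          ∑' k : ℤ, periodTerm (1 / 2 - 2 * a / c) τ k t) := by
  have him : (2 * a / c - τ : ℂ).im = -τ.im := by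
    rw [sub_im, show (2 * a / c : ℂ) = ((2 * a / c : ℝ) : ℂ) by push_cast; rfl, ofReal_im, zero_sub]
  have him2 : (2 * τ).im = 2 * τ.im := by simp
  have hs := (hasSum_sign_sub_errorE (1 / 2 - 2 * a / c) hτ).add (hasSum_ite_eq (0 : ℤ) (1 : ℂ))
  rw [add_comm (1 : ℂ), ← hs.tsum_eq, zwegersR, ← tsum_mul_left, ← tsum_mul_left]
  refine tsum_congr fun k => ?_
  rw [him, him2, zeta_zpow, ← Complex.exp_neg, neg_one_zpow_eq_exp]
  -- `Im u / Im (2τ) = -1/2` cancels the half-integral shift in the argument of `E`.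
  have hdiv : (k : ℝ) + 1 / 2 + -τ.im / (2 * τ.im) = k := by field_simp; ring
  rw [hdiv]
  have hexp : cexp (2 * Real.pi * I * τ * (-1 / 4)) * (cexp (Real.pi * I * k)
      * cexp (-Real.pi * I * (k + 1 / 2) ^ 2 * (2 * τ)
        - 2 * Real.pi * I * (k + 1 / 2) * (2 * a / c - τ)))
      = cexp (-(Real.pi * I * (2 * a / c))) * (cexp (2 * Real.pi * I * k
        * ((1 / 2 - 2 * a / c : ℝ) : ℂ)) * cexp (-2 * Real.pi * I * k ^ 2 * τ)) := by
    rw [← Complex.exp_add, ← Complex.exp_add, ← Complex.exp_add, ← Complex.exp_add]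
    congr 1
    push_cast
    ring
  by_cases hk : k = 0
  · subst hk
    -- At `k = 0` the sign is that of `1/2` and `E(0) = 0`: this term has no counterpart in the
    -- integral and is the summand `1` on the right.
    have hsign : Real.sign (((0 : ℤ) : ℝ) + 1 / 2) = 1 := Real.sign_of_pos (by norm_num)
    rw [hsign, if_pos rfl, if_pos rfl, Int.cast_zero, zero_mul, errorE_zero]
    simp only [Int.cast_zero] at hexp ⊢
    rw [sub_zero, ofReal_one, one_mul, hexp]
    simp
  · rw [if_neg hk, if_neg hk, add_zero]
    linear_combination ((Real.sign ((k : ℝ) + 1 / 2)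
      - errorE (k * Real.sqrt (2 * (2 * τ.im))) : ℝ) : ℂ) * hexp

/-- The overpartition rank function as an Appell sum. -/
lemma one_add_rankSum_eq {q z : ℂ} (hq0 : q ≠ 0) (hq : ‖q‖ < 1) (hz : ‖z‖ = 1) (hz2 : z ^ 2 ≠ 1) :
    1 + 2 * q * rankSum q z = 2 * z * (1 - z) / (1 + z)
      * (qProd (-q) q / qProd q q * appell q q z) + (1 - z) / (1 + z) := by
  have hz0 : z ≠ 0 := norm_ne_zero_iff.1 (by rw [hz]; exact one_ne_zero)
  have hz1 : z ≠ 1 := fun h => hz2 (by rw [h, one_pow])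
  have hzm : 1 + z ≠ 0 := fun h => hz2 (by rw [eq_neg_of_add_eq_zero_right h]; norm_num)
  have h := thetaSum_mul_rankSum_eq hq0 hq hz
  rw [appellReg_eq hq0 hq hq0 hq (mem_annulus_of_norm_eq_one hq0 hq hz) hz1] at h
  have hG := thetaSum_mul_qProd hq0 hq
  generalize qProd (-q) q / qProd q q = g at *
  have h2 : 1 + q * (1 + z⁻¹) * rankSum q z = g * ((1 - z) * appell q q z) := by
    linear_combination g * h - (1 + q * (1 + z⁻¹) * rankSum q z) * hG
  have h3 : z + q * (z + 1) * rankSum q z = z * g * ((1 - z) * appell q q z) := by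
    have hzz : z * z⁻¹ = 1 := mul_inv_cancel₀ hz0
    linear_combination z * h2 - q * rankSum q z * hzz
  field_simp
  linear_combination 2 * h3

/-- The final algebra, with `T`, `S` the two pieces of the Appell sum, `J` the theta product, `u /
v` the theta value, `e = q^{-1/4}`, `s = √2` and `K` the integral. The terms in `K` cancel, and the
constant from `R` supplies `(1 - z) / (1 + z)`. -/
lemma rank_decomposition {z u v J e : ℂ} (hz : z ≠ 0) (hu : u ≠ 0) (hv : v ≠ 0) (hJ : J ≠ 0)
    (he : e ≠ 0) (T S s K : ℂ) :
    2 * z * (1 - z) / (1 + z) * (v / u * (T + z * S)) + (1 - z) / (1 + z)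
      = 2 * z * (1 - z) / (1 + z) * (v * (T * J) / (u * J))
        - I * 2 * z * (1 - z) / (1 + z)
          * (e * (z / (-I * e * (u / v)) * S) + I / 2 * (z⁻¹ * (1 + s * K)))
        + I * s * ((1 - z) / (1 + z)) * (I * K) := by
  have h1 : v * (T * J) / (u * J) = v * T / u := by field_simp
  have h2 : e * (z / (-I * e * (u / v)) * S) = I * z * v * S / u := by
    have hI0 := I_ne_zero
    field_simp
    rw [I_sq]
    ring
  rw [h1, h2]
  have hzz : z * z⁻¹ = 1 := mul_inv_cancel₀ hz
  linear_combination (2 * z ^ 2 * ((1 - z) / (1 + z)) * v * S / u + (1 - z) / (1 + z)) * I_mul_I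
    + I * I * ((1 - z) / (1 + z)) * (1 + s * K) * hzz

end OverpartitionRank

open OverpartitionRank

theorem corollary2p2 (a c : ℤ) (hc : 0 < c) (hac : ¬ c ∣ 2 * a) (τ : UpperHalfPlane) :
    Summable (fun n : ℕ => OverpartitionRank.rankCoeff (OverpartitionRank.zeta c ^ a) n
      * OverpartitionRank.nome τ ^ n) ∧
    OverpartitionRank.IntegrableToIInfty (OverpartitionRank.periodIntegrand a c τ)
      (-(starRingEnd ℂ) (τ : ℂ)) ∧
    OverpartitionRank.rankFunction (OverpartitionRank.zeta c ^ a) τ =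
      2 * OverpartitionRank.zeta c ^ a * (1 - OverpartitionRank.zeta c ^ a)
          / (1 + OverpartitionRank.zeta c ^ a) * OverpartitionRank.productP a c τ
        - Complex.I * 2 * OverpartitionRank.zeta c ^ a * (1 - OverpartitionRank.zeta c ^ a)
          / (1 + OverpartitionRank.zeta c ^ a) * OverpartitionRank.completedN a c τ
        + Complex.I * (Real.sqrt 2 : ℂ) * ((1 - OverpartitionRank.zeta c ^ a)
          / (1 + OverpartitionRank.zeta c ^ a))
          * OverpartitionRank.integralToIInfty (OverpartitionRank.periodIntegrand a c τ)
              (-(starRingEnd ℂ) (τ : ℂ)) := by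
  have hτ : 0 < (τ : ℂ).im := τ.im_pos
  have hz := norm_zeta_zpow a c
  have hz2 := zeta_zpow_sq_ne_one hc hac
  have hq0 := nome_ne_zero τ
  have hq := norm_nome_lt_one hτ
  have hsum := rankFunction_hasSum hz hq0 hq
  refine ⟨hsum.summable, integrableToIInfty_periodIntegrand a c hτ, ?_⟩
  rw [rankFunction, hsum.tsum_eq, one_add_rankSum_eq hq0 hq hz hz2,
    integralToIInfty_periodIntegrand a c hτ, completedN, muTilde, mul_add, mu_eq,
    mul_left_comm _ (Complex.I / 2), zwegersR_eq a c hτ, vartheta_eq_thetaSum, productP,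
    appell_eq_add hq0 hq hz hz2]
  have hP := appell_sq_mul_jacProd hq0 hq (by rw [norm_pow, hz, one_pow]) hz2
  have hG := thetaSum_mul_qProd hq0 hq
  have hp : ‖nome τ ^ 2‖ < 1 := by
    rw [norm_pow]; exact pow_lt_one₀ (norm_nonneg _) hq two_ne_zero
  have hJ : jacProd ((zeta c ^ a) ^ 2) (nome τ ^ 2) ≠ 0 := by
    rw [jacProd_eq hp]
    exact mul_ne_zero (sub_ne_zero.2 (Ne.symm hz2))
      (thetaProd_ne_zero hp (by rw [norm_pow, hz, one_pow]))
  have hqq : qProd (nome τ) (nome τ) ≠ 0 := qProd_ne_zero_of_norm_lt hq hq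
  have hz0 : zeta c ^ a ≠ 0 := norm_ne_zero_iff.1 (by rw [hz]; exact one_ne_zero)
  have hm : qProd (-nome τ) (nome τ) ≠ 0 := qProd_ne_zero_of_norm_lt hq (by rwa [norm_neg])
  -- Rewriting `(q²; q²)_∞²` as Appell sum times theta product makes `P` a multiple of the first
  -- piece of the Appell sum.
  rw [show zeta c ^ (2 * a) = (zeta c ^ a) ^ 2 by
    rw [mul_comm, zpow_mul, zpow_ofNat], ← hP]
  have hθ : thetaSum (nome τ) = qProd (nome τ) (nome τ) / qProd (-nome τ) (nome τ) := by
    rw [eq_div_iff hm]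
    field_simp at hG
    exact hG
  have he := Complex.exp_ne_zero (2 * Real.pi * Complex.I * (τ : ℂ) * (-1 / 4))
  rw [hθ]
  exact rank_decomposition hz0 hqq hm hJ he _ _ _ _
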